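/- For $\beta\in(0,1)$ let $T_\beta:[0,1]\to[0,1]$ be the LSV map, $T_\beta(x)=x(1+2^\beta x^\beta)$ for $0\le x<\tfrac12$ and $T_\beta(x)=2x-1$ for $\tfrac12\le x\le1$. Let $m$ be Lebesgue measure on $[0,1]$, let $g_\beta:[0,1]\to[0,\tfrac12]$ be the inverse of $f_\beta(x)=x(1+2^\beta x^\beta)$, $x\in[0,\tfrac12]$, and let $(\mathcal L_\beta\phi)(x)=\phi(g_\beta(x))/f_\beta'(g_\beta(x))+\tfrac12\phi(\tfrac{x+1}2)$ be the transfer operator of $T_\beta$. Fix $\alpha\in(0,1)$. For $a>1$ let $\mathcal C_*(a)$ be the cone of all $\phi\in C^0(0,1]\cap L^1(m)$ such that $\phi\ge0$, $\phi$ is nonincreasing, $x\mapsto x^{\alpha+1}\phi(x)$ is nondecreasing, and $\int_0^x\phi\,dt\le a\,x^{1-\alpha}\int_0^1\phi\,dm$ for $0<x\le1$. For $b_1,b_2>0$ let $\mathcal C_2=\mathcal C_2(b_1,b_2)$ be the cone of all $\phi\in C^2(0,1]$ with $\phi\ge0$, $|\phi'(x)|\le\frac{b_1}{x}\phi(x)$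 and $|\phi''(x)|\le\frac{b_2}{x^2}\phi(x)$ for $0<x\le1$. Call $(a,b_1,b_2)$ admissible for $\alpha$ if $a>1$, $b_1,b_2>0$, $\mathcal L_\beta(\mathcal C_*(a))\subset\mathcal C_*(a)$ and $\mathcal L_\beta(\mathcal C_2)\subset\mathcal C_2$ for all $0<\beta\le\alpha$. **Proposition.** Admissible parameters exist for every $\alpha\in(0,1)$. Let $(a,b_1,b_2)$ be admissible for $\alpha$ and let $(\beta_k)_{k\in\mathbb Z}\subset(0,1)$ satisfy $\sup_{k\in\mathbb Z}\beta_k=\alpha$. Then there is a sequence $(h_k)_{k\in\mathbb Z}\subset\mathcal C_*(a)\cap\mathcal C_2$ such that $$\mathcal L_{\beta_k}h_k=h_{k+1}\quad\text{and}\quad\int_0^1h_k\,dm=1\qquad\text{for all }k\in\mathbb Z,$$ and it is the unique sequence in $\mathcal C_*(a)$ with these two properties. Moreover, $(h_k\,dm)_{k\in\mathbb Z}$ is the SRB state in the sense of Ruelle: for every $k\in\mathbb Z$, $$h_k\,dm=\lim_{n\to\infty}\,(T_{\beta_{k-1}}\circ\cdots\circ T_{\beta_{k-n}})_*\,m$$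 in total variation. -/

import Mathlib

open Set Filter MeasureTheory

noncomputable section

/-- The left branch `f_α(x) = x (1 + 2^α x^α)` of the LSV map; it is used on `[0, 1/2]`,
which it maps bijectively and increasingly onto `[0, 1]`. -/
def lsvLeft (α x : ℝ) : ℝ := x * (1 + (2 : ℝ) ^ α * x ^ α)

/-- The LSV map `T_α` on `[0, 1]` (its values outside `[0, 1]` are irrelevant). -/
def lsvMap (α x : ℝ) : ℝ := if x < 1 / 2 then lsvLeft α x else 2 * x - 1

/-- The inverse `g_α : [0, 1] → [0, 1/2]` of the left branch. -/
def lsvLeftInv (α : ℝ) : ℝ → ℝ := Function.invFunOn (lsvLeft α) (Icc 0 (1 / 2))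

/-- The transfer operator `(L_α φ)(x) = ∑_{T_α y = x} φ(y) / T_α'(y)`: the sum over the two
inverse branches `y = g_α(x)` and `y = (x + 1) / 2`, the branches being closed at `x = 1`, so that
continuous functions on `(0, 1]` are sent to continuous functions on `(0, 1]`. -/
def lsvTransfer (α : ℝ) (φ : ℝ → ℝ) (x : ℝ) : ℝ :=
  φ (lsvLeftInv α x) / deriv (lsvLeft α) (lsvLeftInv α x) + φ ((x + 1) / 2) / 2

/-- The cone `C_*(a)` (it depends on `α` as well); only the values on `(0, 1]` matter. -/
def coneStar (α a : ℝ) : Set (ℝ → ℝ) :=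
  {φ | ContinuousOn φ (Ioc 0 1) ∧ IntegrableOn φ (Ioc 0 1) ∧
    (∀ x ∈ Ioc (0 : ℝ) 1, 0 ≤ φ x) ∧ AntitoneOn φ (Ioc 0 1) ∧
    MonotoneOn (fun x => x ^ (α + 1) * φ x) (Ioc 0 1) ∧
    ∀ x ∈ Ioc (0 : ℝ) 1, ∫ t in (0 : ℝ)..x, φ t ≤ a * x ^ (1 - α) * ∫ t in (0 : ℝ)..1, φ t}

/-- The cone `C_2(b₁, b₂)`; derivatives at the endpoint `1` are one-sided. -/
def coneTwo (b₁ b₂ : ℝ) : Set (ℝ → ℝ) :=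
  {φ | ContDiffOn ℝ 2 φ (Ioc 0 1) ∧ ∀ x ∈ Ioc (0 : ℝ) 1,
    0 ≤ φ x ∧ |derivWithin φ (Ioc 0 1) x| ≤ b₁ / x * φ x ∧
    |iteratedDerivWithin 2 φ (Ioc 0 1) x| ≤ b₂ / x ^ 2 * φ x}

/-- The condition by which the cone parameters are chosen, given `α` alone: both cones are
invariant under the transfer operators of all LSV maps with parameter in `(0, α]`. -/
structure InvariantConeParameters (α a b₁ b₂ : ℝ) : Prop where
  one_lt_a : 1 < a
  b₁_pos : 0 < b₁
  b₂_pos : 0 < b₂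
  mapsTo_coneStar : ∀ β ∈ Ioc 0 α, MapsTo (lsvTransfer β) (coneStar α a) (coneStar α a)
  mapsTo_coneTwo : ∀ β ∈ Ioc 0 α, MapsTo (lsvTransfer β) (coneTwo b₁ b₂) (coneTwo b₁ b₂)

/-- `L_k h_k = h_{k+1}` on `(0, 1]` and `∫₀¹ h_k = 1` for all `k ∈ ℤ`. -/
def IsEquivariant (β : ℤ → ℝ) (h : ℤ → ℝ → ℝ) : Prop :=
  ∀ k : ℤ, EqOn (lsvTransfer (β k) (h k)) (h (k + 1)) (Ioc 0 1) ∧ ∫ t in (0 : ℝ)..1, h k t = 1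

/-- The composition `T_{β_{j+n-1}} ∘ ⋯ ∘ T_{β_{j+1}} ∘ T_{β_j}` of `n` maps, starting at time `j`. -/
def lsvComp (β : ℤ → ℝ) (j : ℤ) : ℕ → ℝ → ℝ
  | 0 => id
  | n + 1 => lsvMap (β (j + n)) ∘ lsvComp β j n

/-- Lebesgue measure on `[0, 1]`. -/
def lebesgueUnit : Measure ℝ := volume.restrict (Icc 0 1)

/-- The measures `μ_k` are the limits, in total variation (that is, uniformly over measurable
sets), of Lebesgue measure pushed forward from time `k - n` to time `k`, as `n → ∞`. -/
def IsSRBState (β : ℤ → ℝ) (μ : ℤ → Measure ℝ) : Prop :=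
  ∀ k : ℤ, TendstoUniformlyOn
    (fun (n : ℕ) (B : Set ℝ) => (lebesgueUnit.map (lsvComp β (k - n) n)).real B)
    (fun B => (μ k).real B) atTop {B | MeasurableSet B}

end

/-!
Loss of memory drives the proof. Write `L` for a transfer operator with parameter `β ∈ (0, α]`, and
consider two densities `φ`, `ψ` of mass `1` in `C_*(a)` at `L¹`-distance at least `ε`. Elements of
the cone are uniformly Lipschitz away from `0` and carry little mass near `0`, so `φ - ψ` is bounded
below on an interval whose length `l` depends only on `ε`, and likewise `ψ - φ`. Under the maps an
interval of length at least `l` grows by at least `2 l²` per step until it crosses the point `1/2`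
far enough to cover a neighbourhood of the neutral fixed point `0`, and such a neighbourhood stays
covered. Hence after a number of steps depending only on `ε` the images of the positive and of the
negative part of `φ - ψ` are both bounded below near `0`. There they cancel, and the distance drops
by a fixed amount (`exists_integral_transferComp_sub_le`). Iterating, the distance falls below `ε`
after a time uniform in the densities, in the starting time and in the sequence of maps
(`exists_forall_integral_transferComp_sub_lt`). No rate is needed.

By loss of memory the sequence `L_{k-1} ⋯ L_{k-n} 1` is Cauchy in `L¹`, hence pointwise on `(0, 1]`,
and its limit is `h_k`. The inequalities of `C_*(a)` pass to pointwise limits, since `a x^(-α)`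
dominates all densities of the cone. Membership in `C_2` is more delicate, as bounds on `φ''` only
make a limit of class `C^{1,1}`. An auxiliary invariant cone with bounds on three derivatives
(`coneThree`) controls the iterates of `1` and makes their second derivatives equicontinuous
(`coneTwo_of_tendsto`). Uniqueness is loss of memory again, and convergence in total variation is
`L¹`-convergence of densities through the duality `∫_B L φ = ∫_{T⁻¹B} φ`
(`setIntegral_lsvTransfer`).

For the existence of admissible parameters, `C_*(a)` is invariant when `a ≥ 4 / (1 - α)`: the left
branch gains on the scale `x^(1-α)` more than the mass `x` that enters through the right branch
(`add_le_rpow_of_left_branch`). The cones given by derivatives are treated with the Euler derivative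
`x d/dx`. Along the left inverse branch `g` everything is a rational function of `β` and
`t = (2 g)^β`. Differentiating `φ ∘ g` contracts by `r = 1 - β t / p`, where `p = 1 + (β + 1) t` is
the derivative of the branch, while differentiating any weight produces a factor `β t`
(`BranchCoeff.exists_eulerDeriv`). Hence the contraction absorbs the lower order terms uniformly in
`β` and `x`, although it degenerates as `x → 0` and as `β → 0`.
-/

/-! ### The inverse branch of the neutral fixed point -/

section Branch

variable {β : ℝ}

lemma lsvLeft_eq {x : ℝ} (hx : 0 ≤ x) : lsvLeft β x = x * (1 + (2 * x) ^ β) := by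
  rw [lsvLeft, Real.mul_rpow (by norm_num) hx]

lemma lsvLeft_zero : lsvLeft β 0 = 0 := by simp [lsvLeft]

lemma lsvLeft_half : lsvLeft β (1 / 2) = 1 := by
  rw [lsvLeft_eq (by norm_num)]; norm_num

/-- The left branch expands the length `y - x` at least by the factor `1 + 2 (y - x)`, whatever
the value of the parameter in `(0, 1)`. -/
lemma lsvLeft_sub_ge (hβ : β ∈ Ioo (0 : ℝ) 1) {x y : ℝ} (hx : 0 ≤ x) (hxy : x ≤ y)
    (hy : y ≤ 1 / 2) : (y - x) + 2 * (y - x) ^ 2 ≤ lsvLeft β y - lsvLeft β x := by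
  rw [lsvLeft_eq hx, lsvLeft_eq (hx.trans hxy)]
  have h1 : (2 * x) ^ β ≤ (2 * y) ^ β :=
    Real.rpow_le_rpow (by linarith) (by linarith) hβ.1.le
  have h2 : (2 * (y - x)) ^ β ≤ (2 * y) ^ β :=
    Real.rpow_le_rpow (by linarith) (by linarith) hβ.1.le
  have h3 : 2 * (y - x) ≤ (2 * (y - x)) ^ β :=
    Real.self_le_rpow_of_le_one (by linarith) (by linarith) hβ.2.le
  nlinarith [mul_le_mul_of_nonneg_left h1 hx,
    mul_le_mul_of_nonneg_left (h3.trans h2) (sub_nonneg.2 hxy)]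

lemma lsvLeft_strictMonoOn (hβ : β ∈ Ioo (0 : ℝ) 1) :
    StrictMonoOn (lsvLeft β) (Icc 0 (1 / 2)) := by
  intro x hx y hy hxy
  nlinarith [lsvLeft_sub_ge hβ hx.1 hxy.le hy.2]

lemma lsvLeft_continuousOn (hβ : β ∈ Ioo (0 : ℝ) 1) : ContinuousOn (lsvLeft β) (Icc 0 (1 / 2)) := by
  unfold lsvLeft
  exact continuousOn_id.mul (continuousOn_const.add (continuousOn_const.mul
    (continuousOn_id.rpow_const fun x _ => Or.inr hβ.1.le)))

lemma lsvLeft_surjOn (hβ : β ∈ Ioo (0 : ℝ) 1) :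
    SurjOn (lsvLeft β) (Icc 0 (1 / 2)) (Icc 0 1) := by
  have := intermediate_value_Icc (by norm_num : (0 : ℝ) ≤ 1 / 2) (lsvLeft_continuousOn hβ)
  rwa [lsvLeft_zero, lsvLeft_half] at this

lemma lsvLeft_mapsTo (hβ : β ∈ Ioo (0 : ℝ) 1) {y : ℝ} (hy : y ∈ Icc (0 : ℝ) (1 / 2)) :
    lsvLeft β y ∈ Icc (0 : ℝ) 1 := by
  have hm := (lsvLeft_strictMonoOn hβ).monotoneOn
  constructor
  · simpa [lsvLeft_zero] using hm (left_mem_Icc.2 (by norm_num)) hy hy.1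
  · simpa only [lsvLeft_half] using hm hy (right_mem_Icc.2 (by norm_num)) hy.2

lemma lsvLeftInv_mem (hβ : β ∈ Ioo (0 : ℝ) 1) {x : ℝ} (hx : x ∈ Icc (0 : ℝ) 1) :
    lsvLeftInv β x ∈ Icc (0 : ℝ) (1 / 2) :=
  (lsvLeft_surjOn hβ).mapsTo_invFunOn hx

lemma lsvLeft_lsvLeftInv (hβ : β ∈ Ioo (0 : ℝ) 1) {x : ℝ} (hx : x ∈ Icc (0 : ℝ) 1) :
    lsvLeft β (lsvLeftInv β x) = x :=
  (lsvLeft_surjOn hβ).rightInvOn_invFunOn hx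

lemma lsvLeftInv_lsvLeft (hβ : β ∈ Ioo (0 : ℝ) 1) {y : ℝ} (hy : y ∈ Icc (0 : ℝ) (1 / 2)) :
    lsvLeftInv β (lsvLeft β y) = y :=
  (lsvLeft_strictMonoOn hβ).injOn.leftInvOn_invFunOn hy

lemma lsvLeftInv_pos (hβ : β ∈ Ioo (0 : ℝ) 1) {x : ℝ} (hx : x ∈ Ioc (0 : ℝ) 1) :
    0 < lsvLeftInv β x := by
  rcases (lsvLeftInv_mem hβ (Ioc_subset_Icc_self hx)).1.eq_or_lt with h | h
  · have := lsvLeft_lsvLeftInv hβ (Ioc_subset_Icc_self hx)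
    rw [← h, lsvLeft_zero] at this
    exact absurd this hx.1.ne
  · exact h

lemma lsvLeftInv_strictMonoOn (hβ : β ∈ Ioo (0 : ℝ) 1) :
    StrictMonoOn (lsvLeftInv β) (Icc 0 1) := by
  intro x hx y hy hxy
  rw [← (lsvLeft_strictMonoOn hβ).lt_iff_lt (lsvLeftInv_mem hβ hx) (lsvLeftInv_mem hβ hy),
    lsvLeft_lsvLeftInv hβ hx, lsvLeft_lsvLeftInv hβ hy]
  exact hxy

/-- The quantity `t = (2 g)^β ∈ (0, 1]`, where `g = g_β(x)`: all first-order data of the left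
branch at `g` are rational functions of `β` and `t`, since `x = g (1 + t)` and
`f_β'(g) = 1 + (β + 1) t`. -/
noncomputable def branchT (β x : ℝ) : ℝ := (2 * lsvLeftInv β x) ^ β

/-- The derivative `f_β'(g_β(x)) = 1 + (β + 1) t` of the left branch. -/
noncomputable def branchP (β x : ℝ) : ℝ := 1 + (β + 1) * branchT β x

lemma branchT_pos (hβ : β ∈ Ioo (0 : ℝ) 1) {x : ℝ} (hx : x ∈ Ioc (0 : ℝ) 1) : 0 < branchT β x :=
  Real.rpow_pos_of_pos (by linarith [lsvLeftInv_pos hβ hx]) _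

lemma branchT_le_one (hβ : β ∈ Ioo (0 : ℝ) 1) {x : ℝ} (hx : x ∈ Ioc (0 : ℝ) 1) :
    branchT β x ≤ 1 := by
  have := lsvLeftInv_mem hβ (Ioc_subset_Icc_self hx)
  exact Real.rpow_le_one (by linarith [this.1]) (by linarith [this.2]) hβ.1.le

lemma one_le_branchP (hβ : β ∈ Ioo (0 : ℝ) 1) {x : ℝ} (hx : x ∈ Ioc (0 : ℝ) 1) :
    1 ≤ branchP β x := by
  have := mul_pos (add_pos hβ.1 one_pos) (branchT_pos hβ hx)
  unfold branchP; linarith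

lemma branchP_le_three (hβ : β ∈ Ioo (0 : ℝ) 1) {x : ℝ} (hx : x ∈ Ioc (0 : ℝ) 1) :
    branchP β x ≤ 3 := by
  have h1 := branchT_le_one hβ hx
  have h2 := hβ.2
  have h3 := hβ.1
  unfold branchP; nlinarith

lemma lsvLeftInv_mul (hβ : β ∈ Ioo (0 : ℝ) 1) {x : ℝ} (hx : x ∈ Ioc (0 : ℝ) 1) :
    lsvLeftInv β x * (1 + branchT β x) = x := by
  rw [branchT, ← lsvLeft_eq (lsvLeftInv_pos hβ hx).le,
    lsvLeft_lsvLeftInv hβ (Ioc_subset_Icc_self hx)]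

lemma lsvLeftInv_le_self (hβ : β ∈ Ioo (0 : ℝ) 1) {x : ℝ} (hx : x ∈ Ioc (0 : ℝ) 1) :
    lsvLeftInv β x ≤ x := by
  nlinarith [lsvLeftInv_mul hβ hx, mul_pos (lsvLeftInv_pos hβ hx) (branchT_pos hβ hx)]

lemma lsvLeftInv_mapsTo (hβ : β ∈ Ioo (0 : ℝ) 1) : MapsTo (lsvLeftInv β) (Ioc 0 1) (Ioc 0 1) :=
  fun _ hx => ⟨lsvLeftInv_pos hβ hx,
    (lsvLeftInv_mem hβ (Ioc_subset_Icc_self hx)).2.trans (by norm_num)⟩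

lemma right_mapsTo : MapsTo (fun x : ℝ => (x + 1) / 2) (Ioc 0 1) (Ioc 0 1) :=
  fun x hx => ⟨by linarith [hx.1], by linarith [hx.2]⟩

lemma hasDerivAt_lsvLeft {y : ℝ} (hy : 0 < y) :
    HasDerivAt (lsvLeft β) (1 + (β + 1) * (2 * y) ^ β) y := by
  have h := (hasDerivAt_id y).mul
    (((Real.hasDerivAt_rpow_const (p := β) (Or.inl hy.ne')).const_mul ((2 : ℝ) ^ β)).const_add 1)
  have h2 : y ^ (β - 1) * y = y ^ β := by
    rw [Real.rpow_sub_one hy.ne', div_mul_cancel₀ _ hy.ne']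
  refine HasDerivAt.congr_deriv h ?_
  rw [Real.mul_rpow (by norm_num) hy.le]
  simp only [id]
  linear_combination (2 : ℝ) ^ β * β * h2

lemma deriv_lsvLeft_lsvLeftInv (hβ : β ∈ Ioo (0 : ℝ) 1) {x : ℝ} (hx : x ∈ Ioc (0 : ℝ) 1) :
    deriv (lsvLeft β) (lsvLeftInv β x) = branchP β x :=
  (hasDerivAt_lsvLeft (lsvLeftInv_pos hβ hx)).deriv

lemma lsvTransfer_eq (hβ : β ∈ Ioo (0 : ℝ) 1) (φ : ℝ → ℝ) {x : ℝ} (hx : x ∈ Ioc (0 : ℝ) 1) :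
    lsvTransfer β φ x = φ (lsvLeftInv β x) / branchP β x + φ ((x + 1) / 2) / 2 := by
  rw [lsvTransfer, deriv_lsvLeft_lsvLeftInv hβ hx]

lemma lsvLeftInv_continuousOn (hβ : β ∈ Ioo (0 : ℝ) 1) :
    ContinuousOn (lsvLeftInv β) (Icc 0 1) := by
  refine (LipschitzOnWith.of_le_add (f := lsvLeftInv β) ?_).continuousOn
  intro x hx y hy
  have hX := lsvLeftInv_mem hβ hx
  have hY := lsvLeftInv_mem hβ hy
  rcases le_total (lsvLeftInv β x) (lsvLeftInv β y) with h | h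
  · linarith [dist_nonneg (x := x) (y := y)]
  · have := lsvLeft_sub_ge hβ hY.1 h hX.2
    rw [lsvLeft_lsvLeftInv hβ hx, lsvLeft_lsvLeftInv hβ hy] at this
    have h3 := le_abs_self (x - y)
    rw [Real.dist_eq]
    nlinarith [sq_nonneg (lsvLeftInv β x - lsvLeftInv β y)]

lemma hasDerivWithinAt_lsvLeftInv (hβ : β ∈ Ioo (0 : ℝ) 1) {x : ℝ} (hx : x ∈ Ioc (0 : ℝ) 1) :
    HasDerivWithinAt (lsvLeftInv β) (branchP β x)⁻¹ (Ioc 0 1) x := by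
  have hp : branchP β x ≠ 0 := by linarith [one_le_branchP hβ hx]
  have hf : HasDerivAt (lsvLeft β) (branchP β x) (lsvLeftInv β x) :=
    hasDerivAt_lsvLeft (lsvLeftInv_pos hβ hx)
  have hc : ContinuousWithinAt (lsvLeftInv β) (Ioc 0 1) x :=
    ((lsvLeftInv_continuousOn hβ).mono Ioc_subset_Icc_self) x hx
  exact ((hf.hasFDerivAt_equiv hp).hasFDerivWithinAt (s := univ)).of_local_left_inverse
    (by rw [nhdsWithin_univ]; exact hc) hx
    (eventually_mem_nhdsWithin.mono fun y hy => lsvLeft_lsvLeftInv hβ (Ioc_subset_Icc_self hy))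

end Branch

/-! ### Duality between the map and its transfer operator -/

section Duality

variable {β : ℝ}

lemma measurable_lsvLeft : Measurable (lsvLeft β) := by
  unfold lsvLeft
  exact measurable_id.mul (measurable_const.add (measurable_const.mul
    (measurable_id.pow_const β)))

lemma measurable_lsvMap : Measurable (lsvMap β) :=
  Measurable.ite measurableSet_Iio measurable_lsvLeft (by fun_prop)

lemma lsvLeft_image_preimage_inter (hβ : β ∈ Ioo (0 : ℝ) 1) (B : Set ℝ) :
    lsvLeft β '' (lsvLeft β ⁻¹' B ∩ Ioc 0 (1 / 2)) = B ∩ Ioc 0 1 := by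
  ext x
  constructor
  · rintro ⟨y, ⟨hyB, hy⟩, rfl⟩
    refine ⟨hyB, ?_, (lsvLeft_mapsTo hβ (Ioc_subset_Icc_self hy)).2⟩
    simpa [lsvLeft_zero] using lsvLeft_strictMonoOn hβ (left_mem_Icc.2 (by norm_num))
      (Ioc_subset_Icc_self hy) hy.1
  · rintro ⟨hxB, hx⟩
    have hx' := Ioc_subset_Icc_self hx
    exact ⟨lsvLeftInv β x, ⟨by rwa [mem_preimage, lsvLeft_lsvLeftInv hβ hx'],
      lsvLeftInv_pos hβ hx, (lsvLeftInv_mem hβ hx').2⟩, lsvLeft_lsvLeftInv hβ hx'⟩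

lemma right_image_preimage_inter (B : Set ℝ) :
    (fun y : ℝ => 2 * y - 1) '' ((fun y : ℝ => 2 * y - 1) ⁻¹' B ∩ Ioc (1 / 2) 1) =
      B ∩ Ioc 0 1 := by
  ext x
  constructor
  · rintro ⟨y, ⟨hyB, hy⟩, rfl⟩
    exact ⟨hyB, by simp only; linarith [hy.1], by simp only; linarith [hy.2]⟩
  · rintro ⟨hxB, hx⟩
    have e : 2 * ((x + 1) / 2) - 1 = x := by ring
    exact ⟨(x + 1) / 2, ⟨by simpa only [mem_preimage, e] using hxB, by linarith [hx.1],
      by linarith [hx.2]⟩, e⟩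

/-- Change of variables along the left branch. -/
lemma setIntegral_left_branch (hβ : β ∈ Ioo (0 : ℝ) 1) (φ : ℝ → ℝ) {B : Set ℝ}
    (hB : MeasurableSet B) :
    (∫ x in B ∩ Ioc 0 1, φ (lsvLeftInv β x) / deriv (lsvLeft β) (lsvLeftInv β x)) =
        ∫ y in lsvLeft β ⁻¹' B ∩ Ioc 0 (1 / 2), φ y ∧
      (IntegrableOn (fun x => φ (lsvLeftInv β x) / deriv (lsvLeft β) (lsvLeftInv β x))
        (B ∩ Ioc 0 1) ↔ IntegrableOn φ (lsvLeft β ⁻¹' B ∩ Ioc 0 (1 / 2))) := by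
  have hs : MeasurableSet (lsvLeft β ⁻¹' B ∩ Ioc 0 (1 / 2)) :=
    (measurable_lsvLeft hB).inter measurableSet_Ioc
  have hd : ∀ y ∈ lsvLeft β ⁻¹' B ∩ Ioc 0 (1 / 2), HasDerivWithinAt (lsvLeft β)
      (deriv (lsvLeft β) y) (lsvLeft β ⁻¹' B ∩ Ioc 0 (1 / 2)) y := fun y hy =>
    (hasDerivAt_lsvLeft hy.2.1).differentiableAt.hasDerivAt.hasDerivWithinAt
  have hi : InjOn (lsvLeft β) (lsvLeft β ⁻¹' B ∩ Ioc 0 (1 / 2)) :=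
    (lsvLeft_strictMonoOn hβ).injOn.mono (inter_subset_right.trans Ioc_subset_Icc_self)
  have hc : EqOn (fun y => |deriv (lsvLeft β) y| • (φ (lsvLeftInv β (lsvLeft β y)) /
      deriv (lsvLeft β) (lsvLeftInv β (lsvLeft β y)))) φ
      (lsvLeft β ⁻¹' B ∩ Ioc 0 (1 / 2)) := by
    intro y hy
    have hpos : 0 < deriv (lsvLeft β) y := by
      rw [(hasDerivAt_lsvLeft hy.2.1).deriv]
      have := mul_pos (add_pos hβ.1 one_pos)
        (Real.rpow_pos_of_pos (by linarith [hy.2.1] : 0 < 2 * y) β)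
      linarith
    simp only [lsvLeftInv_lsvLeft hβ (Ioc_subset_Icc_self hy.2), smul_eq_mul, abs_of_pos hpos]
    field_simp
  rw [← lsvLeft_image_preimage_inter hβ B, integral_image_eq_integral_abs_deriv_smul hs hd hi,
    integrableOn_image_iff_integrableOn_abs_deriv_smul hs hd hi]
  exact ⟨setIntegral_congr_fun hs hc, integrableOn_congr_fun hc hs⟩

/-- Change of variables along the right branch. -/
lemma setIntegral_right_branch (φ : ℝ → ℝ) {B : Set ℝ} (hB : MeasurableSet B) :
    (∫ x in B ∩ Ioc 0 1, φ ((x + 1) / 2) / 2) =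
        ∫ y in (fun y : ℝ => 2 * y - 1) ⁻¹' B ∩ Ioc (1 / 2) 1, φ y ∧
      (IntegrableOn (fun x => φ ((x + 1) / 2) / 2) (B ∩ Ioc 0 1) ↔
        IntegrableOn φ ((fun y : ℝ => 2 * y - 1) ⁻¹' B ∩ Ioc (1 / 2) 1)) := by
  have hs : MeasurableSet ((fun y : ℝ => 2 * y - 1) ⁻¹' B ∩ Ioc (1 / 2) 1) :=
    ((by fun_prop : Measurable fun y : ℝ => 2 * y - 1) hB).inter measurableSet_Ioc
  have hd : ∀ y ∈ (fun y : ℝ => 2 * y - 1) ⁻¹' B ∩ Ioc (1 / 2) 1,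
      HasDerivWithinAt (fun y : ℝ => 2 * y - 1) 2
        ((fun y : ℝ => 2 * y - 1) ⁻¹' B ∩ Ioc (1 / 2) 1) y := fun y _ => by
    simpa using (((hasDerivAt_id y).const_mul 2).sub_const 1).hasDerivWithinAt
  have hi : InjOn (fun y : ℝ => 2 * y - 1)
      ((fun y : ℝ => 2 * y - 1) ⁻¹' B ∩ Ioc (1 / 2) 1) := fun x _ y _ h => by
    simpa using h
  have hc : EqOn (fun y => |(2 : ℝ)| • (φ ((2 * y - 1 + 1) / 2) / 2)) φ
      ((fun y : ℝ => 2 * y - 1) ⁻¹' B ∩ Ioc (1 / 2) 1) := by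
    intro y _
    have e : (2 * y - 1 + 1) / 2 = y := by ring
    simp only [e, smul_eq_mul, abs_two]
    ring
  rw [← right_image_preimage_inter B, integral_image_eq_integral_abs_deriv_smul hs hd hi,
    integrableOn_image_iff_integrableOn_abs_deriv_smul hs hd hi]
  exact ⟨setIntegral_congr_fun hs hc, integrableOn_congr_fun hc hs⟩

lemma lsvTransfer_integrableOn (hβ : β ∈ Ioo (0 : ℝ) 1) {φ : ℝ → ℝ}
    (hφ : IntegrableOn φ (Ioc 0 1)) : IntegrableOn (lsvTransfer β φ) (Ioc 0 1) := by
  have h1 := (setIntegral_left_branch hβ φ MeasurableSet.univ).2.2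
    (hφ.mono_set (inter_subset_right.trans (Ioc_subset_Ioc_right (by norm_num))))
  have h2 := (setIntegral_right_branch φ MeasurableSet.univ).2.2
    (hφ.mono_set (inter_subset_right.trans (Ioc_subset_Ioc_left (by norm_num))))
  rw [univ_inter] at h1 h2
  exact h1.add h2

lemma setIntegral_lsvTransfer_eq_add (hβ : β ∈ Ioo (0 : ℝ) 1) {φ : ℝ → ℝ}
    (hφ : IntegrableOn φ (Ioc 0 1)) {B : Set ℝ} (hB : MeasurableSet B) :
    ∫ x in B ∩ Ioc 0 1, lsvTransfer β φ x =
      (∫ y in lsvLeft β ⁻¹' B ∩ Ioc 0 (1 / 2), φ y) +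
        ∫ y in (fun y : ℝ => 2 * y - 1) ⁻¹' B ∩ Ioc (1 / 2) 1, φ y := by
  have h1 := setIntegral_left_branch hβ φ hB
  have h2 := setIntegral_right_branch φ hB
  rw [← h1.1, ← h2.1]
  exact integral_add
    (h1.2.2 (hφ.mono_set (inter_subset_right.trans (Ioc_subset_Ioc_right (by norm_num)))))
    (h2.2.2 (hφ.mono_set (inter_subset_right.trans (Ioc_subset_Ioc_left (by norm_num)))))

/-- The transfer operator is dual to composition with the map. -/
lemma setIntegral_lsvTransfer (hβ : β ∈ Ioo (0 : ℝ) 1) {φ : ℝ → ℝ}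
    (hφ : IntegrableOn φ (Ioc 0 1)) {B : Set ℝ} (hB : MeasurableSet B) :
    ∫ x in B ∩ Ioc 0 1, lsvTransfer β φ x = ∫ y in lsvMap β ⁻¹' B ∩ Ioc 0 1, φ y := by
  have hdisj : Disjoint (lsvMap β ⁻¹' B ∩ Ioc 0 (1 / 2)) (lsvMap β ⁻¹' B ∩ Ioc (1 / 2) 1) :=
    (Ioc_disjoint_Ioc_of_le le_rfl).mono inter_subset_right inter_subset_right
  rw [setIntegral_lsvTransfer_eq_add hβ hφ hB,
    ← Ioc_union_Ioc_eq_Ioc (by norm_num : (0 : ℝ) ≤ 1 / 2) (by norm_num : (1 / 2 : ℝ) ≤ 1),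
    inter_union_distrib_left, setIntegral_union hdisj
      ((measurable_lsvMap hB).inter measurableSet_Ioc)
      (hφ.mono_set (inter_subset_right.trans (Ioc_subset_Ioc_right (by norm_num))))
      (hφ.mono_set (inter_subset_right.trans (Ioc_subset_Ioc_left (by norm_num))))]
  congr 1
  · -- the two domains differ at most by the point `1 / 2`
    refine setIntegral_congr_set ?_
    filter_upwards [Measure.ae_ne volume (1 / 2 : ℝ)] with y hy
    refine propext (and_congr_left fun hy' => ?_)
    have : y < 1 / 2 := lt_of_le_of_ne hy'.2 hy
    change lsvLeft β y ∈ B ↔ lsvMap β y ∈ B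
    rw [lsvMap, if_pos this]
  · congr 2
    ext y
    refine and_congr_left fun hy' => ?_
    simp only [mem_preimage, lsvMap, not_lt.2 hy'.1.le, if_false]

lemma integral_lsvTransfer (hβ : β ∈ Ioo (0 : ℝ) 1) {φ : ℝ → ℝ}
    (hφ : IntegrableOn φ (Ioc 0 1)) :
    ∫ x in Ioc 0 1, lsvTransfer β φ x = ∫ y in Ioc 0 1, φ y := by
  simpa using setIntegral_lsvTransfer hβ hφ MeasurableSet.univ

lemma setIntegral_Ioc_lsvTransfer (hβ : β ∈ Ioo (0 : ℝ) 1) {φ : ℝ → ℝ}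
    (hφ : IntegrableOn φ (Ioc 0 1)) {x : ℝ} (hx : x ∈ Ioc (0 : ℝ) 1) :
    ∫ y in Ioc 0 x, lsvTransfer β φ y =
      (∫ y in Ioc 0 (lsvLeftInv β x), φ y) + ∫ y in Ioc (1 / 2) ((x + 1) / 2), φ y := by
  have hx' := Ioc_subset_Icc_self hx
  have hg := lsvLeftInv_mem hβ hx'
  have e0 : Ioc 0 x ∩ Ioc 0 1 = Ioc 0 x := inter_eq_left.2 (Ioc_subset_Ioc_right hx.2)
  have e1 : lsvLeft β ⁻¹' Ioc 0 x ∩ Ioc 0 (1 / 2) = Ioc 0 (lsvLeftInv β x) := by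
    ext y
    constructor
    · rintro ⟨h1, h2⟩
      refine ⟨h2.1, ((lsvLeft_strictMonoOn hβ).le_iff_le (Ioc_subset_Icc_self h2) hg).1 ?_⟩
      rw [lsvLeft_lsvLeftInv hβ hx']; exact h1.2
    · rintro ⟨h1, h2⟩
      have hy : y ∈ Icc (0 : ℝ) (1 / 2) := ⟨h1.le, h2.trans hg.2⟩
      refine ⟨⟨?_, ?_⟩, h1, hy.2⟩
      · simpa [lsvLeft_zero] using
          lsvLeft_strictMonoOn hβ (left_mem_Icc.2 (by norm_num)) hy h1
      · rw [← lsvLeft_lsvLeftInv hβ hx']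
        exact (lsvLeft_strictMonoOn hβ).monotoneOn hy hg h2
  have e2 : (fun y : ℝ => 2 * y - 1) ⁻¹' Ioc 0 x ∩ Ioc (1 / 2) 1 =
      Ioc (1 / 2) ((x + 1) / 2) := by
    ext y
    simp only [mem_inter_iff, mem_preimage, mem_Ioc]
    constructor
    · rintro ⟨⟨h1, h2⟩, h3, h4⟩; constructor <;> linarith
    · rintro ⟨h1, h2⟩
      have := hx.2
      refine ⟨⟨?_, ?_⟩, ?_, ?_⟩ <;> linarith
  have := setIntegral_lsvTransfer_eq_add hβ hφ (B := Ioc 0 x) measurableSet_Ioc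
  rwa [e0, e1, e2] at this

end Duality

/-! ### Invariance of the cone of decreasing densities -/

section ConeStar

variable {α β a : ℝ}

lemma branchT_monotoneOn (hβ : β ∈ Ioo (0 : ℝ) 1) : MonotoneOn (branchT β) (Ioc 0 1) := by
  intro x hx y hy hxy
  refine Real.rpow_le_rpow (by linarith [lsvLeftInv_pos hβ hx]) ?_ hβ.1.le
  linarith [(lsvLeftInv_strictMonoOn hβ).monotoneOn (Ioc_subset_Icc_self hx)
    (Ioc_subset_Icc_self hy) hxy]

lemma branchP_continuousOn (hβ : β ∈ Ioo (0 : ℝ) 1) : ContinuousOn (branchP β) (Ioc 0 1) := by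
  have h1 := (lsvLeftInv_continuousOn hβ).mono Ioc_subset_Icc_self
  exact continuousOn_const.add (continuousOn_const.mul
    ((continuousOn_const.mul h1).rpow_const fun x _ => Or.inr hβ.1.le))

lemma lsvTransfer_continuousOn (hβ : β ∈ Ioo (0 : ℝ) 1) {φ : ℝ → ℝ}
    (hφ : ContinuousOn φ (Ioc 0 1)) : ContinuousOn (lsvTransfer β φ) (Ioc 0 1) := by
  have h1 := (lsvLeftInv_continuousOn hβ).mono Ioc_subset_Icc_self
  refine ContinuousOn.congr ?_ fun x hx => lsvTransfer_eq hβ φ hx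
  refine ((hφ.comp h1 (lsvLeftInv_mapsTo hβ)).div (branchP_continuousOn hβ) fun x hx =>
    (by linarith [one_le_branchP hβ hx])).add ?_
  exact (hφ.comp (by fun_prop) right_mapsTo).div_const 2

lemma lsvTransfer_nonneg (hβ : β ∈ Ioo (0 : ℝ) 1) {φ : ℝ → ℝ}
    (hφ : ∀ x ∈ Ioc (0 : ℝ) 1, 0 ≤ φ x) : ∀ x ∈ Ioc (0 : ℝ) 1, 0 ≤ lsvTransfer β φ x := by
  intro x hx
  rw [lsvTransfer_eq hβ φ hx]
  have h1 := hφ _ (lsvLeftInv_mapsTo hβ hx)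
  have h2 := hφ _ (right_mapsTo hx)
  have h3 := one_le_branchP hβ hx
  positivity

lemma lsvTransfer_antitoneOn (hβ : β ∈ Ioo (0 : ℝ) 1) {φ : ℝ → ℝ}
    (h0 : ∀ x ∈ Ioc (0 : ℝ) 1, 0 ≤ φ x) (hφ : AntitoneOn φ (Ioc 0 1)) :
    AntitoneOn (lsvTransfer β φ) (Ioc 0 1) := by
  intro x hx y hy hxy
  rw [lsvTransfer_eq hβ φ hx, lsvTransfer_eq hβ φ hy]
  have hg := (lsvLeftInv_strictMonoOn hβ).monotoneOn (Ioc_subset_Icc_self hx)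
    (Ioc_subset_Icc_self hy) hxy
  have hp : branchP β x ≤ branchP β y := by
    have := branchT_monotoneOn hβ hx hy hxy
    have := hβ.1
    unfold branchP; gcongr
  have h1 := hφ (lsvLeftInv_mapsTo hβ hx) (lsvLeftInv_mapsTo hβ hy) hg
  have h2 : φ ((y + 1) / 2) ≤ φ ((x + 1) / 2) :=
    hφ (right_mapsTo hx) (right_mapsTo hy) (by simp only; linarith)
  have h3 := one_le_branchP hβ hx
  have h4 := h0 _ (lsvLeftInv_mapsTo hβ hx)
  gcongr

/-- The factor `(1 + t)^(α + 1) / f_β'` by which the left branch multiplies `x^(α + 1) φ(x)` is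
nondecreasing in `t`, because `β ≤ α`. -/
lemma one_add_rpow_div_mono (hβ : 0 ≤ β) (hβα : β ≤ α) {s t : ℝ} (hs : 0 ≤ s) (hst : s ≤ t) :
    (1 + s) ^ (α + 1) / (1 + (β + 1) * s) ≤ (1 + t) ^ (α + 1) / (1 + (β + 1) * t) := by
  have ht : 0 ≤ t := hs.trans hst
  set u := (t - s) / (1 + s) with hu
  have hus : u * (1 + s) = t - s := by rw [hu]; field_simp
  have hu0 : 0 ≤ u := div_nonneg (by linarith) (by linarith)
  have e : 1 + t = (1 + s) * (1 + u) := by linarith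
  have hB := one_add_mul_self_le_rpow_one_add (by linarith : -1 ≤ u) (by linarith : 1 ≤ α + 1)
  rw [e, Real.mul_rpow (by linarith) (by linarith),
    div_le_div_iff₀ (by positivity) (by positivity), mul_assoc]
  refine mul_le_mul_of_nonneg_left ?_ (by positivity)
  have h1 : (1 + (α + 1) * u) * (1 + (β + 1) * s) ≤ (1 + u) ^ (α + 1) * (1 + (β + 1) * s) :=
    mul_le_mul_of_nonneg_right hB (by positivity)
  have h2 : 1 + (β + 1) * t ≤ (1 + (α + 1) * u) * (1 + (β + 1) * s) := by
    have h3 : (β + 1) * (t - s) ≤ (α + 1) * (u * (1 + s)) := by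
      rw [hus]; exact mul_le_mul_of_nonneg_right (by linarith) (by linarith)
    have hα : 0 ≤ α + 1 := by linarith
    have h4 : 0 ≤ (α + 1) * u * (β * s) := by positivity
    nlinarith
  exact h2.trans h1

lemma lsvTransfer_monotoneOn_rpow_mul (hβ : β ∈ Ioo (0 : ℝ) 1) (hβα : β ≤ α) {φ : ℝ → ℝ}
    (h0 : ∀ x ∈ Ioc (0 : ℝ) 1, 0 ≤ φ x)
    (hφ : MonotoneOn (fun x => x ^ (α + 1) * φ x) (Ioc 0 1)) :
    MonotoneOn (fun x => x ^ (α + 1) * lsvTransfer β φ x) (Ioc 0 1) := by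
  have hα : 0 < α + 1 := by linarith [hβ.1]
  -- each term is `y^(α + 1) φ(y)` at the preimage `y`, times the factor `(x / y)^(α + 1) / T'(y)`
  have key : ∀ x ∈ Ioc (0 : ℝ) 1, x ^ (α + 1) * lsvTransfer β φ x =
      (lsvLeftInv β x ^ (α + 1) * φ (lsvLeftInv β x)) *
        ((1 + branchT β x) ^ (α + 1) / (1 + (β + 1) * branchT β x)) +
      (((x + 1) / 2) ^ (α + 1) * φ ((x + 1) / 2)) * (2 - 2 / (x + 1)) ^ (α + 1) / 2 := by
    intro x hx
    have hx0 := hx.1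
    have hg := lsvLeftInv_pos hβ hx
    have ht := branchT_pos hβ hx
    have e1 : x ^ (α + 1) = lsvLeftInv β x ^ (α + 1) * (1 + branchT β x) ^ (α + 1) := by
      rw [← Real.mul_rpow hg.le (by linarith), lsvLeftInv_mul hβ hx]
    have e2 : x ^ (α + 1) = ((x + 1) / 2) ^ (α + 1) * (2 - 2 / (x + 1)) ^ (α + 1) := by
      have : 2 - 2 / (x + 1) = 2 * x / (x + 1) := by field_simp; ring
      rw [this, ← Real.mul_rpow (by linarith) (by positivity)]
      congr 1; field_simp
    rw [lsvTransfer_eq hβ φ hx, mul_add]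
    congr 1
    · rw [e1, branchP]; ring
    · rw [e2]; ring
  intro x hx y hy hxy
  simp only
  rw [key x hx, key y hy]
  have hx0 := hx.1
  have hy0 := hy.1
  have hβ0 := hβ.1
  have hg := (lsvLeftInv_strictMonoOn hβ).monotoneOn (Ioc_subset_Icc_self hx)
    (Ioc_subset_Icc_self hy) hxy
  have hg0 := lsvLeftInv_pos hβ hx
  have ht := branchT_pos hβ hx
  have ht' := branchT_pos hβ hy
  have hp := one_le_branchP hβ hy
  unfold branchP at hp
  have h1 : lsvLeftInv β x ^ (α + 1) * φ (lsvLeftInv β x) ≤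
      lsvLeftInv β y ^ (α + 1) * φ (lsvLeftInv β y) :=
    hφ (lsvLeftInv_mapsTo hβ hx) (lsvLeftInv_mapsTo hβ hy) hg
  have h2 : ((x + 1) / 2) ^ (α + 1) * φ ((x + 1) / 2) ≤
      ((y + 1) / 2) ^ (α + 1) * φ ((y + 1) / 2) :=
    hφ (right_mapsTo hx) (right_mapsTo hy) (by simp only; linarith)
  have h3 := one_add_rpow_div_mono hβ0.le hβα ht.le (branchT_monotoneOn hβ hx hy hxy)
  have h4 : 0 ≤ 2 - 2 / (x + 1) := by
    rw [sub_nonneg, div_le_iff₀ (by linarith)]; linarith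
  have h5 : (2 - 2 / (x + 1)) ^ (α + 1) ≤ (2 - 2 / (y + 1)) ^ (α + 1) := by
    refine Real.rpow_le_rpow h4 ?_ hα.le
    gcongr
  have h6 := h0 _ (lsvLeftInv_mapsTo hβ hx)
  have h7 : 0 ≤ φ ((x + 1) / 2) := h0 _ (right_mapsTo hx)
  have h8 := h0 _ (lsvLeftInv_mapsTo hβ hy)
  have h9 : 0 ≤ φ ((y + 1) / 2) := h0 _ (right_mapsTo hy)
  have h10 := lsvLeftInv_pos hβ hy
  refine add_le_add (mul_le_mul h1 h3 (by positivity) (by positivity))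
    (div_le_div_of_nonneg_right (mul_le_mul h2 h5 (Real.rpow_nonneg h4 _) (by positivity))
      (by norm_num))

lemma mul_le_setIntegral_of_antitoneOn {φ : ℝ → ℝ} (hi : IntegrableOn φ (Ioc 0 1))
    (hφ : AntitoneOn φ (Ioc 0 1)) {x : ℝ} (hx : x ∈ Ioc (0 : ℝ) 1) :
    x * φ x ≤ ∫ t in Ioc 0 x, φ t := by
  have h : ∫ _t in Ioc 0 x, φ x ≤ ∫ t in Ioc 0 x, φ t :=
    setIntegral_mono_on (integrableOn_const (by simp)) (hi.mono_set (Ioc_subset_Ioc_right hx.2))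
      measurableSet_Ioc fun t ht => hφ ⟨ht.1, ht.2.trans hx.2⟩ hx ht.2
  simpa [hx.1.le] using h

lemma setIntegral_Ioc_le {φ : ℝ → ℝ} (hi : IntegrableOn φ (Ioc 0 1))
    (h0 : ∀ x ∈ Ioc (0 : ℝ) 1, 0 ≤ φ x) {S : Set ℝ} (hS : S ⊆ Ioc 0 1) :
    ∫ t in S, φ t ≤ ∫ t in Ioc 0 1, φ t :=
  setIntegral_mono_set hi ((ae_restrict_iff' measurableSet_Ioc).2 (Eventually.of_forall h0))
    (LE.le.eventuallyLE hS)

/-- The gain of the left branch on the scale `x ^ (1 - α)` dominates the mass `x` that the right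
branch may bring into `(0, x]`. -/
lemma add_le_rpow_of_left_branch (hα : α ∈ Ioo (0 : ℝ) 1) (hβ : β ∈ Ioc 0 α)
    (ha : 4 / (1 - α) ≤ a) {x : ℝ} (hx : x ∈ Ioc (0 : ℝ) 1) :
    a * lsvLeftInv β x ^ (1 - α) + x ≤ a * x ^ (1 - α) := by
  have hβ' : β ∈ Ioo (0 : ℝ) 1 := ⟨hβ.1, hβ.2.trans_lt hα.2⟩
  have hg := lsvLeftInv_pos hβ' hx
  have hg2 := (lsvLeftInv_mem hβ' (Ioc_subset_Icc_self hx)).2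
  have ht := branchT_pos hβ' hx
  have ht1 := branchT_le_one hβ' hx
  have hx' := lsvLeftInv_mul hβ' hx
  set g := lsvLeftInv β x with hgdef
  set t := branchT β x with htdef
  have h1α : 0 < 1 - α := by linarith [hα.2]
  have hα0 := hα.1
  -- Bernoulli's inequality for the exponent `α`, divided into `1 + t`
  have h1 : 1 + (1 - α) * t / 2 ≤ (1 + t) ^ (1 - α) := by
    have hB := rpow_one_add_le_one_add_mul_self (by linarith : -1 ≤ t) hα.1.le hα.2.le
    have hpos : 0 < (1 + t) ^ α := Real.rpow_pos_of_pos (by linarith) _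
    rw [Real.rpow_sub (by linarith), Real.rpow_one, le_div_iff₀ hpos]
    refine (mul_le_mul_of_nonneg_left hB (by positivity)).trans ?_
    have : 0 ≤ (1 - α) * t * (1 - α * t) := by
      refine mul_nonneg (by positivity) ?_
      nlinarith [hα.2]
    nlinarith
  have h2 : (2 * g) ^ α ≤ t := by
    rw [htdef, branchT]
    exact Real.rpow_le_rpow_of_exponent_ge (by linarith) (by linarith) hβ.2
  have h3 : g ≤ g ^ (1 - α) * (2 * g) ^ α := by
    have e : g = g ^ (1 - α) * g ^ α := by
      rw [← Real.rpow_add hg]; simp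
    have : g ^ α ≤ (2 * g) ^ α := Real.rpow_le_rpow hg.le (by linarith) hα.1.le
    calc g = g ^ (1 - α) * g ^ α := e
      _ ≤ _ := mul_le_mul_of_nonneg_left this (Real.rpow_nonneg hg.le _)
  have hG : 0 ≤ g ^ (1 - α) := Real.rpow_nonneg hg.le _
  have h4 : g ≤ g ^ (1 - α) * t := h3.trans (mul_le_mul_of_nonneg_left h2 hG)
  have h5 : x ^ (1 - α) = g ^ (1 - α) * (1 + t) ^ (1 - α) := by
    rw [← hx', Real.mul_rpow hg.le (by linarith)]
  have h6 : 4 ≤ a * (1 - α) := by rwa [div_le_iff₀ h1α] at ha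
  have ha0 : 0 < a := lt_of_lt_of_le (by positivity) ha
  have h7 : a * (g ^ (1 - α) * (1 + (1 - α) * t / 2)) ≤ a * x ^ (1 - α) := by
    rw [h5]; gcongr
  have h8 : 4 * (g ^ (1 - α) * t) ≤ a * (1 - α) * (g ^ (1 - α) * t) :=
    mul_le_mul_of_nonneg_right h6 (by positivity)
  nlinarith

/-- The cone `C_*(a)` is invariant for all parameters in `(0, α]` as soon as `a ≥ 4 / (1 - α)`. -/
theorem lsvTransfer_mapsTo_coneStar (hα : α ∈ Ioo (0 : ℝ) 1) (hβ : β ∈ Ioc 0 α)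
    (ha : 4 / (1 - α) ≤ a) : MapsTo (lsvTransfer β) (coneStar α a) (coneStar α a) := by
  have hβ' : β ∈ Ioo (0 : ℝ) 1 := ⟨hβ.1, hβ.2.trans_lt hα.2⟩
  rintro φ ⟨hc, hi, h0, hanti, hmono, hint⟩
  refine ⟨lsvTransfer_continuousOn hβ' hc, lsvTransfer_integrableOn hβ' hi,
    lsvTransfer_nonneg hβ' h0, lsvTransfer_antitoneOn hβ' h0 hanti,
    lsvTransfer_monotoneOn_rpow_mul hβ' hβ.2 h0 hmono, fun x hx => ?_⟩
  have hg := lsvLeftInv_mapsTo hβ' hx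
  have h1 := hint _ hg
  rw [intervalIntegral.integral_of_le hg.1.le, intervalIntegral.integral_of_le zero_le_one] at h1
  rw [intervalIntegral.integral_of_le hx.1.le, intervalIntegral.integral_of_le zero_le_one,
    integral_lsvTransfer hβ' hi, setIntegral_Ioc_lsvTransfer hβ' hi hx]
  set m := ∫ t in Ioc 0 1, φ t with hm
  have hhalf : (1 / 2 : ℝ) ∈ Ioc (0 : ℝ) 1 := by norm_num
  have h2 : φ (1 / 2) ≤ 2 * m := by
    have := mul_le_setIntegral_of_antitoneOn hi hanti hhalf
    have := setIntegral_Ioc_le hi h0 (Ioc_subset_Ioc_right hhalf.2 : Ioc (0 : ℝ) (1 / 2) ⊆ _)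
    linarith
  have h3 : ∫ y in Ioc (1 / 2) ((x + 1) / 2), φ y ≤ m * x := by
    have hsub : Ioc (1 / 2) ((x + 1) / 2) ⊆ Ioc (0 : ℝ) 1 :=
      Ioc_subset_Ioc (by norm_num) (by linarith [hx.2])
    have h : ∫ y in Ioc (1 / 2) ((x + 1) / 2), φ y ≤
        ∫ _y in Ioc (1 / 2) ((x + 1) / 2), 2 * m :=
      setIntegral_mono_on (hi.mono_set hsub) (integrableOn_const (by simp))
        measurableSet_Ioc fun t ht => (hanti hhalf (hsub ht) ht.1.le).trans h2
    refine h.trans_eq ?_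
    rw [setIntegral_const, measureReal_def, Real.volume_Ioc,
      ENNReal.toReal_ofReal (by linarith [hx.1]), smul_eq_mul]
    ring
  have hm0 : 0 ≤ m := setIntegral_nonneg measurableSet_Ioc h0
  have h4 := mul_le_mul_of_nonneg_right (add_le_rpow_of_left_branch hα hβ ha hx) hm0
  nlinarith

lemma one_mem_coneStar (hα : α ∈ Ioo (0 : ℝ) 1) (ha : 1 < a) :
    (fun _ => 1 : ℝ → ℝ) ∈ coneStar α a := by
  refine ⟨continuousOn_const, integrableOn_const (by simp), fun _ _ => zero_le_one,
    antitoneOn_const, fun x hx y _ hxy => ?_, fun x hx => ?_⟩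
  · simpa using Real.rpow_le_rpow hx.1.le hxy (by linarith [hα.1])
  · have h1 : x ≤ x ^ (1 - α) :=
      Real.self_le_rpow_of_le_one hx.1.le hx.2 (by linarith [hα.1])
    have h2 := Real.rpow_nonneg hx.1.le (1 - α)
    simp only [intervalIntegral.integral_const, smul_eq_mul]
    nlinarith

end ConeStar

/-! ### Compositions of transfer operators -/

/-- The composition `L_{β_{j+n-1}} ∘ ⋯ ∘ L_{β_j}` of `n` transfer operators, starting at time `j`;
it is the transfer operator of `lsvComp β j n`. -/
noncomputable def transferComp (β : ℤ → ℝ) (j : ℤ) : ℕ → (ℝ → ℝ) → ℝ → ℝ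
  | 0, φ => φ
  | n + 1, φ => lsvTransfer (β (j + n)) (transferComp β j n φ)

section TransferComp

variable {β : ℤ → ℝ}

lemma transferComp_succ (j : ℤ) (n : ℕ) (φ : ℝ → ℝ) :
    transferComp β j (n + 1) φ = lsvTransfer (β (j + n)) (transferComp β j n φ) := rfl

lemma transferComp_add (j : ℤ) (m n : ℕ) (φ : ℝ → ℝ) :
    transferComp β j (m + n) φ = transferComp β (j + m) n (transferComp β j m φ) := by
  induction n with
  | zero => rfl
  | succ n ih =>
    rw [← add_assoc, transferComp_succ, transferComp_succ, ih]
    push_cast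
    rw [add_assoc]

lemma lsvTransfer_sub (b : ℝ) (φ ψ : ℝ → ℝ) :
    lsvTransfer b (φ - ψ) = lsvTransfer b φ - lsvTransfer b ψ := by
  ext x
  simp only [lsvTransfer, Pi.sub_apply]
  ring

lemma transferComp_sub (j : ℤ) (n : ℕ) (φ ψ : ℝ → ℝ) :
    transferComp β j n (φ - ψ) = transferComp β j n φ - transferComp β j n ψ := by
  induction n with
  | zero => rfl
  | succ n ih => rw [transferComp_succ, ih, lsvTransfer_sub]; rfl

lemma lsvTransfer_eqOn {b : ℝ} (hb : b ∈ Ioo (0 : ℝ) 1) {φ ψ : ℝ → ℝ}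
    (h : EqOn φ ψ (Ioc 0 1)) : EqOn (lsvTransfer b φ) (lsvTransfer b ψ) (Ioc 0 1) := by
  intro x hx
  rw [lsvTransfer_eq hb φ hx, lsvTransfer_eq hb ψ hx, h (lsvLeftInv_mapsTo hb hx),
    h (right_mapsTo hx)]

lemma transferComp_mapsTo {C : Set (ℝ → ℝ)} (h : ∀ k, MapsTo (lsvTransfer (β k)) C C) (j : ℤ)
    (n : ℕ) : MapsTo (transferComp β j n) C C := by
  induction n with
  | zero => exact fun φ hφ => hφ
  | succ n ih => exact fun φ hφ => h _ (ih hφ)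

lemma transferComp_integrableOn (hβ : ∀ k, β k ∈ Ioo (0 : ℝ) 1) (j : ℤ) (n : ℕ) {φ : ℝ → ℝ}
    (hφ : IntegrableOn φ (Ioc 0 1)) : IntegrableOn (transferComp β j n φ) (Ioc 0 1) := by
  induction n with
  | zero => exact hφ
  | succ n ih => exact lsvTransfer_integrableOn (hβ _) ih

lemma integral_transferComp (hβ : ∀ k, β k ∈ Ioo (0 : ℝ) 1) (j : ℤ) (n : ℕ) {φ : ℝ → ℝ}
    (hφ : IntegrableOn φ (Ioc 0 1)) :
    ∫ x in Ioc 0 1, transferComp β j n φ x = ∫ x in Ioc 0 1, φ x := by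
  induction n with
  | zero => rfl
  | succ n ih =>
    rw [transferComp_succ, integral_lsvTransfer (hβ _) (transferComp_integrableOn hβ j n hφ), ih]

lemma transferComp_nonneg (hβ : ∀ k, β k ∈ Ioo (0 : ℝ) 1) (j : ℤ) (n : ℕ) {φ : ℝ → ℝ}
    (hφ : ∀ x ∈ Ioc (0 : ℝ) 1, 0 ≤ φ x) : ∀ x ∈ Ioc (0 : ℝ) 1, 0 ≤ transferComp β j n φ x := by
  induction n with
  | zero => exact hφ
  | succ n ih => exact lsvTransfer_nonneg (hβ _) ih

lemma measurable_lsvComp (j : ℤ) (n : ℕ) : Measurable (lsvComp β j n) := by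
  induction n with
  | zero => exact measurable_id
  | succ n ih => exact measurable_lsvMap.comp ih

lemma setIntegral_transferComp (hβ : ∀ k, β k ∈ Ioo (0 : ℝ) 1) (j : ℤ) (n : ℕ) {φ : ℝ → ℝ}
    (hφ : IntegrableOn φ (Ioc 0 1)) {B : Set ℝ} (hB : MeasurableSet B) :
    ∫ x in B ∩ Ioc 0 1, transferComp β j n φ x = ∫ y in lsvComp β j n ⁻¹' B ∩ Ioc 0 1, φ y := by
  induction n generalizing B with
  | zero => rfl
  | succ n ih =>
    rw [transferComp_succ, setIntegral_lsvTransfer (hβ _) (transferComp_integrableOn hβ j n hφ) hB,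
      ih (measurable_lsvMap hB)]
    rfl

end TransferComp

/-! ### Spreading of mass to a neighbourhood of the neutral fixed point -/

section Spreading

lemma lsvTransfer_ge_of_left {b c : ℝ} (hb : b ∈ Ioo (0 : ℝ) 1) (hc : 0 ≤ c) {φ : ℝ → ℝ}
    (h0 : ∀ x ∈ Ioc (0 : ℝ) 1, 0 ≤ φ x) {x : ℝ} (hx : x ∈ Ioc (0 : ℝ) 1)
    (h : c ≤ φ (lsvLeftInv b x)) : c / 3 ≤ lsvTransfer b φ x := by
  rw [lsvTransfer_eq hb φ hx]
  have h1 : 0 ≤ φ ((x + 1) / 2) := h0 _ (right_mapsTo hx)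
  have h2 := one_le_branchP hb hx
  have h3 : c / 3 ≤ φ (lsvLeftInv b x) / branchP b x :=
    div_le_div₀ (hc.trans h) h (by linarith) (branchP_le_three hb hx)
  linarith

lemma lsvTransfer_ge_of_right {b c : ℝ} (hb : b ∈ Ioo (0 : ℝ) 1) (hc : 0 ≤ c) {φ : ℝ → ℝ}
    (h0 : ∀ x ∈ Ioc (0 : ℝ) 1, 0 ≤ φ x) {x : ℝ} (hx : x ∈ Ioc (0 : ℝ) 1)
    (h : c ≤ φ ((x + 1) / 2)) : c / 3 ≤ lsvTransfer b φ x := by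
  rw [lsvTransfer_eq hb φ hx]
  have h2 := one_le_branchP hb hx
  have h3 : 0 ≤ φ (lsvLeftInv b x) / branchP b x :=
    div_nonneg (h0 _ (lsvLeftInv_mapsTo hb hx)) (by linarith)
  linarith

/-- One step of the spreading of mass. An interval of length at least `l` on which a density is
bounded below either covers a neighbourhood of the neutral fixed point after one step, or is mapped
onto (or contains a piece that is mapped onto) an interval that is longer by `2 l²`. -/
lemma exists_longer_interval {b c l u v : ℝ} (hb : b ∈ Ioo (0 : ℝ) 1) (hc : 0 ≤ c)
    {φ : ℝ → ℝ} (h0 : ∀ x ∈ Ioc (0 : ℝ) 1, 0 ≤ φ x) (hl : 0 < l) (hl' : l ≤ 1 / 4)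
    (hu : 0 < u) (hv : v ≤ 1) (huv : l ≤ v - u) (h : ∀ x ∈ Icc u v, c ≤ φ x) :
    (∀ x ∈ Ioc 0 (l / 2), c / 3 ≤ lsvTransfer b φ x) ∨
    ∃ u' v', 0 < u' ∧ v' ≤ 1 ∧ (v - u) + 2 * l ^ 2 ≤ v' - u' ∧
      ∀ x ∈ Icc u' v', c / 3 ≤ lsvTransfer b φ x := by
  -- the image of an interval `[u, w]` on the left of `1 / 2`
  have left : ∀ w, u ≤ w → w ≤ v → w ≤ 1 / 2 → 0 < lsvLeft b u ∧ lsvLeft b w ≤ 1 ∧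
      ∀ x ∈ Icc (lsvLeft b u) (lsvLeft b w), c / 3 ≤ lsvTransfer b φ x := by
    intro w huw hwv hw
    have hU : u ∈ Icc (0 : ℝ) (1 / 2) := ⟨hu.le, huw.trans hw⟩
    have hW : w ∈ Icc (0 : ℝ) (1 / 2) := ⟨hu.le.trans huw, hw⟩
    have hpos : 0 < lsvLeft b u := by
      simpa [lsvLeft_zero] using
        lsvLeft_strictMonoOn hb (left_mem_Icc.2 (by norm_num)) hU hu
    refine ⟨hpos, (lsvLeft_mapsTo hb hW).2, fun x hx => ?_⟩
    have hx1 : x ∈ Ioc (0 : ℝ) 1 :=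
      ⟨hpos.trans_le hx.1, hx.2.trans (lsvLeft_mapsTo hb hW).2⟩
    have hm := (lsvLeftInv_strictMonoOn hb).monotoneOn
    refine lsvTransfer_ge_of_left hb hc h0 hx1 (h _ ⟨?_, ?_⟩)
    · have := hm (lsvLeft_mapsTo hb hU) (Ioc_subset_Icc_self hx1) hx.1
      rwa [lsvLeftInv_lsvLeft hb hU] at this
    · have := hm (Ioc_subset_Icc_self hx1) (lsvLeft_mapsTo hb hW) hx.2
      rw [lsvLeftInv_lsvLeft hb hW] at this
      exact this.trans hwv
  rcases le_or_gt v (1 / 2) with hv2 | hv2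
  · obtain ⟨h1, h2, h3⟩ := left v (by linarith) le_rfl hv2
    refine Or.inr ⟨_, _, h1, h2, ?_, h3⟩
    have := lsvLeft_sub_ge hb hu.le (by linarith) hv2
    nlinarith
  rcases lt_or_ge (1 / 2) u with hu2 | hu2
  · refine Or.inr ⟨2 * u - 1, 2 * v - 1, by linarith, by linarith, by nlinarith, fun x hx => ?_⟩
    exact lsvTransfer_ge_of_right hb hc h0 ⟨by linarith [hx.1], by linarith [hx.2]⟩
      (h _ ⟨by linarith [hx.1], by linarith [hx.2]⟩)
  rcases le_or_gt (l / 4) (v - 1 / 2) with h4 | h4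
  · refine Or.inl fun x hx => ?_
    exact lsvTransfer_ge_of_right hb hc h0 ⟨hx.1, by linarith [hx.2]⟩
      (h _ ⟨by linarith [hx.1], by linarith [hx.2]⟩)
  · obtain ⟨h1, h2, h3⟩ := left (1 / 2) hu2 hv2.le le_rfl
    refine Or.inr ⟨_, _, h1, h2, ?_, h3⟩
    -- by convexity, the left branch expands `[u, 1 / 2]` at least by the factor `2`
    have h5 : u * (2 * u) ^ b ≤ u :=
      mul_le_of_le_one_right hu.le (Real.rpow_le_one (by linarith) (by linarith) hb.1.le)
    rw [lsvLeft_half, lsvLeft_eq hu.le]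
    nlinarith

/-- After a number `N` of steps that depends on `l` only, a density that is at least `c` on an
interval of length `l` is at least `c / 3 ^ N` on `(0, l / 2]`. -/
lemma transferComp_ge_of_interval {β : ℤ → ℝ} (hβ : ∀ k, β k ∈ Ioo (0 : ℝ) 1) {c l : ℝ}
    (hc : 0 ≤ c) (hl : 0 < l) (hl' : l ≤ 1 / 4) {N : ℕ} (hN : 1 ≤ 2 * N * l ^ 2) (j : ℤ)
    {φ : ℝ → ℝ} (h0 : ∀ x ∈ Ioc (0 : ℝ) 1, 0 ≤ φ x) {u : ℝ} (hu : 0 < u) (hul : u + l ≤ 1)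
    (h : ∀ x ∈ Icc u (u + l), c ≤ φ x) :
    ∀ x ∈ Ioc 0 (l / 2), c / 3 ^ N ≤ transferComp β j N φ x := by
  have key : ∀ n : ℕ, (∀ x ∈ Ioc 0 (l / 2), c / 3 ^ n ≤ transferComp β j n φ x) ∨
      ∃ u v, 0 < u ∧ v ≤ 1 ∧ l + 2 * n * l ^ 2 ≤ v - u ∧
        ∀ x ∈ Icc u v, c / 3 ^ n ≤ transferComp β j n φ x := by
    intro n
    induction n with
    | zero => exact Or.inr ⟨u, u + l, hu, hul, by simp, by simpa [transferComp] using h⟩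
    | succ n ih =>
      have hp := transferComp_nonneg hβ j n h0
      have e : c / 3 ^ (n + 1) = c / 3 ^ n / 3 := by rw [pow_succ, div_div]
      rw [e, transferComp_succ]
      rcases ih with ih | ⟨u, v, hu, hv, huv, h⟩
      · refine Or.inl fun x hx => ?_
        have hx1 : x ∈ Ioc (0 : ℝ) 1 := ⟨hx.1, by linarith [hx.2]⟩
        exact lsvTransfer_ge_of_left (hβ _) (by positivity) hp hx1
          (ih _ ⟨lsvLeftInv_pos (hβ _) hx1, (lsvLeftInv_le_self (hβ _) hx1).trans hx.2⟩)
      · have hpos : 0 ≤ 2 * (n : ℝ) * l ^ 2 := by positivity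
        rcases exists_longer_interval (hβ _) (by positivity) hp hl hl' hu hv (by linarith) h with
          h1 | ⟨u', v', h1, h2, h3, h4⟩
        · exact Or.inl h1
        · refine Or.inr ⟨u', v', h1, h2, ?_, h4⟩
          push_cast
          linarith
  rcases key N with h1 | ⟨u', v', h1, h2, h3, -⟩
  · exact h1
  · linarith

end Spreading

/-! ### Loss of memory -/

section MemoryLoss

variable {α a : ℝ}

/-- The elements of total mass `1` of the cone `C_*(a)`. -/
def unitConeStar (α a : ℝ) : Set (ℝ → ℝ) := {φ ∈ coneStar α a | ∫ t in Ioc 0 1, φ t = 1}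

lemma unitConeStar_integral_le {φ : ℝ → ℝ} (hφ : φ ∈ unitConeStar α a) {x : ℝ}
    (hx : x ∈ Ioc (0 : ℝ) 1) : ∫ t in Ioc 0 x, φ t ≤ a * x ^ (1 - α) := by
  have := hφ.1.2.2.2.2.2 x hx
  rwa [intervalIntegral.integral_of_le hx.1.le, intervalIntegral.integral_of_le zero_le_one,
    hφ.2, mul_one] at this

lemma unitConeStar_mul_le {φ : ℝ → ℝ} (hφ : φ ∈ unitConeStar α a) {x : ℝ}
    (hx : x ∈ Ioc (0 : ℝ) 1) : x * φ x ≤ 1 := by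
  obtain ⟨⟨-, hi, h0, hanti, -, -⟩, h1⟩ := hφ
  rw [← h1]
  exact (mul_le_setIntegral_of_antitoneOn hi hanti hx).trans
    (setIntegral_Ioc_le hi h0 (Ioc_subset_Ioc_right hx.2))

/-- The densities of the cone are uniformly Lipschitz away from `0`. -/
lemma unitConeStar_sub_le (hα : α ∈ Ioo (0 : ℝ) 1) {φ : ℝ → ℝ} (hφ : φ ∈ unitConeStar α a)
    {z x y : ℝ} (hz : 0 < z) (hzx : z ≤ x) (hxy : x ≤ y) (hy : y ≤ 1) :
    φ x - φ y ≤ 2 / z ^ 2 * (y - x) := by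
  have hx0 : 0 < x := hz.trans_le hzx
  have hy0 : 0 < y := hx0.trans_le hxy
  have hx : x ∈ Ioc (0 : ℝ) 1 := ⟨hx0, hxy.trans hy⟩
  have h1 : x ^ (α + 1) * φ x ≤ y ^ (α + 1) * φ y := hφ.1.2.2.2.2.1 hx ⟨hy0, hy⟩ hxy
  have h2 : (x / y) ^ (α + 1) * φ x ≤ φ y := by
    rw [Real.div_rpow hx0.le hy0.le, div_mul_eq_mul_div, div_le_iff₀ (Real.rpow_pos_of_pos hy0 _)]
    linarith
  have h3 : (x / y) ^ 2 ≤ (x / y) ^ (α + 1) := by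
    rw [← Real.rpow_natCast]
    exact Real.rpow_le_rpow_of_exponent_ge (by positivity) ((div_le_one hy0).2 hxy)
      (by push_cast; linarith [hα.2])
  have h4 := hφ.1.2.2.1 x hx
  have h5 : φ x ≤ 1 / z := by
    rw [le_div_iff₀ hz]
    nlinarith [unitConeStar_mul_le hφ hx]
  have h6 : 1 - (x / y) ^ 2 ≤ 2 / z * (y - x) := by
    have h7 : 1 - (x / y) ^ 2 ≤ 2 * (1 - x / y) := by nlinarith [sq_nonneg (1 - x / y)]
    have h8 : 1 - x / y = 1 / y * (y - x) := by field_simp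
    have h9 : 1 / y * (y - x) ≤ 1 / z * (y - x) :=
      mul_le_mul_of_nonneg_right (one_div_le_one_div_of_le hz (hzx.trans hxy)) (by linarith)
    calc _ ≤ 2 * (1 / z * (y - x)) := by linarith
      _ = _ := by ring
  have h10 : (x / y) ^ 2 * φ x ≤ φ y := (mul_le_mul_of_nonneg_right h3 h4).trans h2
  calc φ x - φ y ≤ φ x * (1 - (x / y) ^ 2) := by linarith
    _ ≤ φ x * (2 / z * (y - x)) := mul_le_mul_of_nonneg_left h6 h4
    _ ≤ 1 / z * (2 / z * (y - x)) := by
      refine mul_le_mul_of_nonneg_right h5 ?_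
      have : 0 ≤ y - x := by linarith
      positivity
    _ = _ := by field_simp

/-- If two densities of the cone differ at a point by `c`, then they differ by `c / 2` on an
interval on its left whose length depends only on `c` and on the distance of the point to `0`. -/
lemma unitConeStar_sub_ge (hα : α ∈ Ioo (0 : ℝ) 1) {φ ψ : ℝ → ℝ} (hφ : φ ∈ unitConeStar α a)
    (hψ : ψ ∈ unitConeStar α a) {c x₀ l x : ℝ} (hx₀ : 0 < x₀)
    (hl : l ≤ x₀ / 2) (hlc : l ≤ c * x₀ ^ 2 / 16) (hx : x ∈ Icc x₀ 1) (h : c ≤ φ x - ψ x) :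
    ∀ y ∈ Icc (x - l) x, c / 2 ≤ φ y - ψ y := by
  intro y hy
  have hyx : x₀ / 2 ≤ y := by linarith [hy.1, hx.1]
  have h1 : φ x ≤ φ y :=
    hφ.1.2.2.2.1 ⟨by linarith, hy.2.trans hx.2⟩ ⟨by linarith [hx.1], hx.2⟩ hy.2
  have h2 := unitConeStar_sub_le hα hψ (half_pos hx₀) hyx hy.2 hx.2
  have h3 : 2 / (x₀ / 2) ^ 2 * (x - y) ≤ 2 / (x₀ / 2) ^ 2 * (c * x₀ ^ 2 / 16) :=
    mul_le_mul_of_nonneg_left (by linarith [hy.1]) (by positivity)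
  have h4 : 2 / (x₀ / 2) ^ 2 * (c * x₀ ^ 2 / 16) = c / 2 := by
    field_simp; ring
  linarith

/-- Densities of the cone that are close in `L¹` are close pointwise, locally uniformly on
`(0, 1]`. -/
lemma unitConeStar_sub_lt_of_integral_lt (hα : α ∈ Ioo (0 : ℝ) 1) {c x : ℝ} (hc : 0 < c)
    (hx : x ∈ Ioc (0 : ℝ) 1) : ∃ δ > 0, ∀ φ ∈ unitConeStar α a, ∀ ψ ∈ unitConeStar α a,
      ∫ t in Ioc 0 1, |φ t - ψ t| < δ → φ x - ψ x < c := by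
  have hx0 := hx.1
  set l := min (x / 2) (c * x ^ 2 / 16) with hl
  have hl0 : 0 < l := lt_min (by positivity) (by positivity)
  refine ⟨c / 2 * l, by positivity, fun φ hφ ψ hψ h => ?_⟩
  by_contra! hge
  have hlx : l ≤ x / 2 := min_le_left _ _
  have h1 := unitConeStar_sub_ge hα hφ hψ hx0 hlx (min_le_right _ _) ⟨le_rfl, hx.2⟩ hge
  have hi : IntegrableOn (fun t => |φ t - ψ t|) (Ioc 0 1) := (hφ.1.2.1.sub hψ.1.2.1).abs
  have hsub : Ioc (x - l) x ⊆ Ioc 0 1 := Ioc_subset_Ioc (by linarith) hx.2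
  have h2 : ∫ _t in Ioc (x - l) x, c / 2 ≤ ∫ t in Ioc (x - l) x, |φ t - ψ t| :=
    setIntegral_mono_on (integrableOn_const (by simp)) (hi.mono_set hsub) measurableSet_Ioc
      fun t ht => (h1 t (Ioc_subset_Icc_self ht)).trans (le_abs_self _)
  have h3 := setIntegral_Ioc_le hi (fun t _ => abs_nonneg (φ t - ψ t)) hsub
  rw [setIntegral_const, measureReal_def, Real.volume_Ioc,
    ENNReal.toReal_ofReal (by linarith), smul_eq_mul] at h2
  linarith

/-- Densities of the cone at `L¹`-distance `ε` differ by `ε / 8` at some point of `[x₀, 1]`,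
provided that the mass of `(0, x₀]` is small. -/
lemma exists_sub_ge_of_integral_ge {φ ψ : ℝ → ℝ} (hφ : φ ∈ unitConeStar α a)
    (hψ : ψ ∈ unitConeStar α a) {ε x₀ : ℝ} (hε : 0 < ε) (hx₀ : x₀ ∈ Ioc (0 : ℝ) 1)
    (hm : a * x₀ ^ (1 - α) ≤ ε / 8) (h : ε ≤ ∫ t in Ioc 0 1, |φ t - ψ t|) :
    ∃ x ∈ Icc x₀ 1, ε / 8 ≤ φ x - ψ x := by
  by_contra! hlt
  have hi : IntegrableOn (fun t => φ t - ψ t) (Ioc 0 1) := hφ.1.2.1.sub hψ.1.2.1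
  have hpos : IntegrableOn (fun t => max (φ t - ψ t) 0) (Ioc 0 1) := hi.pos_part
  have e : ∫ t in Ioc 0 1, |φ t - ψ t| = 2 * ∫ t in Ioc 0 1, max (φ t - ψ t) 0 := by
    have h1 : ∀ t, |φ t - ψ t| = 2 * max (φ t - ψ t) 0 - (φ t - ψ t) := by
      intro t
      rcases le_total 0 (φ t - ψ t) with h | h
      · rw [abs_of_nonneg h, max_eq_left h]; ring
      · rw [abs_of_nonpos h, max_eq_right h]; ring
    simp_rw [h1]
    rw [integral_sub (hpos.const_mul 2) hi, integral_const_mul]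
    have : ∫ t in Ioc 0 1, (φ t - ψ t) = 0 := by
      rw [integral_sub hφ.1.2.1 hψ.1.2.1, hφ.2, hψ.2, sub_self]
    rw [this, sub_zero]
  have hsub1 : Ioc 0 x₀ ⊆ Ioc (0 : ℝ) 1 := Ioc_subset_Ioc_right hx₀.2
  have hsub2 : Ioc x₀ 1 ⊆ Ioc (0 : ℝ) 1 := Ioc_subset_Ioc_left hx₀.1.le
  have h1 : ∫ t in Ioc 0 x₀, max (φ t - ψ t) 0 ≤ ∫ t in Ioc 0 x₀, φ t :=
    setIntegral_mono_on (hpos.mono_set hsub1) (hφ.1.2.1.mono_set hsub1) measurableSet_Ioc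
      fun t ht => max_le (by linarith [hψ.1.2.2.1 t (hsub1 ht)]) (hφ.1.2.2.1 t (hsub1 ht))
  have h2 : ∫ t in Ioc x₀ 1, max (φ t - ψ t) 0 ≤ ∫ _t in Ioc x₀ 1, ε / 8 :=
    setIntegral_mono_on (hpos.mono_set hsub2) (integrableOn_const (by simp)) measurableSet_Ioc
      fun t ht => max_le (hlt t (Ioc_subset_Icc_self ht)).le (by positivity)
  rw [setIntegral_const, measureReal_def, Real.volume_Ioc,
    ENNReal.toReal_ofReal (by linarith [hx₀.2]), smul_eq_mul] at h2
  have h3 := setIntegral_union (Ioc_disjoint_Ioc_of_le (le_refl x₀)) measurableSet_Ioc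
    (hpos.mono_set hsub1) (hpos.mono_set hsub2)
  rw [Ioc_union_Ioc_eq_Ioc hx₀.1.le hx₀.2] at h3
  have h4 := unitConeStar_integral_le hφ hx₀
  have h5 := hx₀.1
  nlinarith

lemma exists_rpow_le (hα : α ∈ Ioo (0 : ℝ) 1) (a : ℝ) {ε : ℝ} (hε : 0 < ε) :
    ∃ x ∈ Ioc (0 : ℝ) 1, a * x ^ (1 - α) ≤ ε := by
  have h1 : Tendsto (fun x : ℝ => a * x ^ (1 - α)) (nhds 0) (nhds 0) := by
    have := (Real.continuousAt_rpow_const 0 (1 - α)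
      (Or.inr (by linarith [hα.2]))).tendsto.const_mul a
    rwa [Real.zero_rpow (by linarith [hα.2]), mul_zero] at this
  have h2 := (h1.mono_left (nhdsWithin_le_nhds (s := Ioi 0))).eventually_le_const hε
  obtain ⟨x, hx, hx'⟩ := (h2.and (Ioc_mem_nhdsGT zero_lt_one)).exists
  exact ⟨x, hx', hx⟩

/-- As long as two densities of the cone are at distance at least `ε`, a fixed number of steps
reduces their distance by a fixed amount: both the positive and the negative part of the difference
have spread over a neighbourhood of `0`, where they cancel. -/
lemma exists_integral_transferComp_sub_le (hα : α ∈ Ioo (0 : ℝ) 1) (a : ℝ) {β : ℤ → ℝ}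
    (hβ : ∀ k, β k ∈ Ioo (0 : ℝ) 1) {ε : ℝ} (hε : 0 < ε) :
    ∃ N : ℕ, ∃ δ > 0, ∀ j, ∀ φ ∈ unitConeStar α a, ∀ ψ ∈ unitConeStar α a,
      ε ≤ ∫ t in Ioc 0 1, |φ t - ψ t| →
      ∫ t in Ioc 0 1, |transferComp β j N φ t - transferComp β j N ψ t| ≤
        (∫ t in Ioc 0 1, |φ t - ψ t|) - δ := by
  obtain ⟨x₀, hx₀, hax⟩ := exists_rpow_le hα a (show 0 < ε / 8 by positivity)
  have hx₀0 := hx₀.1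
  set l := min (min (x₀ / 2) (ε / 8 * x₀ ^ 2 / 16)) (1 / 4) with hl
  have hl0 : 0 < l := lt_min (lt_min (by positivity) (by positivity)) (by norm_num)
  have hl1 : l ≤ x₀ / 2 := (min_le_left _ _).trans (min_le_left _ _)
  have hl2 : l ≤ ε / 8 * x₀ ^ 2 / 16 := (min_le_left _ _).trans (min_le_right _ _)
  have hl3 : l ≤ 1 / 4 := min_le_right _ _
  obtain ⟨N, hN⟩ := exists_nat_ge (1 / (2 * l ^ 2))
  have hN' : 1 ≤ 2 * N * l ^ 2 := by
    rw [div_le_iff₀ (by positivity)] at hN; linarith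
  set c := ε / 8 / 2 / 3 ^ N with hc
  have hc0 : 0 < c := by positivity
  refine ⟨N, c * l, by positivity, fun j φ hφ ψ hψ h => ?_⟩
  -- the lower bound for the positive part of a difference of two densities
  have low : ∀ φ ∈ unitConeStar α a, ∀ ψ ∈ unitConeStar α a,
      ε ≤ ∫ t in Ioc 0 1, |φ t - ψ t| →
      ∀ x ∈ Ioc 0 (l / 2), c ≤ transferComp β j N (fun t => max (φ t - ψ t) 0) x := by
    intro φ hφ ψ hψ h
    obtain ⟨x, hx, hxc⟩ := exists_sub_ge_of_integral_ge hφ hψ hε hx₀ hax h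
    have h1 := unitConeStar_sub_ge hα hφ hψ hx₀0 hl1 hl2 hx hxc
    refine transferComp_ge_of_interval hβ (by positivity) hl0 hl3 hN' j
      (fun t _ => le_max_right _ _) (u := x - l) (by linarith [hx.1]) (by linarith [hx.2]) ?_
    rw [sub_add_cancel]
    exact fun y hy => (h1 y hy).trans (le_max_left _ _)
  have hi := hφ.1.2.1.sub hψ.1.2.1
  have hip : IntegrableOn (fun t => max (φ t - ψ t) 0) (Ioc 0 1) := hi.pos_part
  have him : IntegrableOn (fun t => max (ψ t - φ t) 0) (Ioc 0 1) :=
    (hψ.1.2.1.sub hφ.1.2.1).pos_part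
  set P := transferComp β j N (fun t => max (φ t - ψ t) 0) with hP
  set Q := transferComp β j N (fun t => max (ψ t - φ t) 0) with hQ
  have hiP : IntegrableOn P (Ioc 0 1) := transferComp_integrableOn hβ j N hip
  have hiQ : IntegrableOn Q (Ioc 0 1) := transferComp_integrableOn hβ j N him
  have hP1 := low φ hφ ψ hψ h
  have hQ1 := low ψ hψ φ hφ (by simpa only [abs_sub_comm] using h)
  have hP0 : ∀ x ∈ Ioc (0 : ℝ) 1, 0 ≤ P x :=
    transferComp_nonneg hβ j N fun t _ => le_max_right _ _
  have hQ0 : ∀ x ∈ Ioc (0 : ℝ) 1, 0 ≤ Q x :=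
    transferComp_nonneg hβ j N fun t _ => le_max_right _ _
  have hPQ : transferComp β j N φ - transferComp β j N ψ = P - Q := by
    rw [hP, hQ, ← transferComp_sub, ← transferComp_sub]
    congr 1
    ext t
    simp only [Pi.sub_apply]
    rcases le_total 0 (φ t - ψ t) with h | h
    · rw [max_eq_left h, max_eq_right (by linarith), sub_zero]
    · rw [max_eq_right h, max_eq_left (by linarith)]; ring
  have hsub : Ioc 0 (l / 2) ⊆ Ioc (0 : ℝ) 1 := Ioc_subset_Ioc_right (by linarith)
  have hind : IntegrableOn ((Ioc 0 (l / 2)).indicator fun _ => 2 * c) (Ioc 0 1) :=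
    (integrableOn_const (by simp)).indicator measurableSet_Ioc
  have hbound : ∀ t ∈ Ioc (0 : ℝ) 1, |transferComp β j N φ t - transferComp β j N ψ t| ≤
      P t + Q t - (Ioc 0 (l / 2)).indicator (fun _ => 2 * c) t := by
    intro t ht
    have := congrFun hPQ t
    simp only [Pi.sub_apply] at this
    rw [this]
    have h1 := hP0 t ht
    have h2 := hQ0 t ht
    by_cases htl : t ∈ Ioc 0 (l / 2)
    · rw [indicator_of_mem htl, abs_le]
      constructor <;> linarith [hP1 t htl, hQ1 t htl]
    · rw [indicator_of_notMem htl, abs_le]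
      constructor <;> linarith
  have hmono := setIntegral_mono_on
    (((transferComp_integrableOn hβ j N hφ.1.2.1).sub
      (transferComp_integrableOn hβ j N hψ.1.2.1)).abs) ((hiP.add hiQ).sub hind)
    measurableSet_Ioc hbound
  refine hmono.trans_eq ?_
  have e1 : ∫ t in Ioc 0 1, |φ t - ψ t| =
      (∫ t in Ioc 0 1, max (φ t - ψ t) 0) + ∫ t in Ioc 0 1, max (ψ t - φ t) 0 := by
    rw [← integral_add hip him]
    congr 1
    ext t
    rcases le_total 0 (φ t - ψ t) with h | h
    · rw [abs_of_nonneg h, max_eq_left h, max_eq_right (by linarith), add_zero]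
    · rw [abs_of_nonpos h, max_eq_right h, max_eq_left (by linarith)]; ring
  have e2 : ∫ t in Ioc 0 1, (Ioc 0 (l / 2)).indicator (fun _ => 2 * c) t = c * l := by
    rw [setIntegral_indicator measurableSet_Ioc, inter_eq_right.2 hsub, setIntegral_const,
      measureReal_def, Real.volume_Ioc, ENNReal.toReal_ofReal (by linarith), smul_eq_mul]
    ring
  calc _ = (∫ t in Ioc 0 1, (P t + Q t)) -
        ∫ t in Ioc 0 1, (Ioc 0 (l / 2)).indicator (fun _ => 2 * c) t :=
        integral_sub (hiP.add hiQ) hind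
    _ = _ := by
      rw [integral_add hiP hiQ, e2, e1, hP, hQ, integral_transferComp hβ j N hip,
        integral_transferComp hβ j N him]

lemma integral_lsvTransfer_sub_le {b : ℝ} (hb : b ∈ Ioo (0 : ℝ) 1) {φ ψ : ℝ → ℝ}
    (hφ : IntegrableOn φ (Ioc 0 1)) (hψ : IntegrableOn ψ (Ioc 0 1)) :
    ∫ t in Ioc 0 1, |lsvTransfer b φ t - lsvTransfer b ψ t| ≤ ∫ t in Ioc 0 1, |φ t - ψ t| := by
  have hi : IntegrableOn (fun t => |φ t - ψ t|) (Ioc 0 1) := (hφ.sub hψ).abs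
  rw [← integral_lsvTransfer hb hi]
  refine setIntegral_mono_on ((lsvTransfer_integrableOn hb hφ).sub
    (lsvTransfer_integrableOn hb hψ)).abs (lsvTransfer_integrableOn hb hi) measurableSet_Ioc ?_
  intro x hx
  have hp := one_le_branchP hb hx
  rw [lsvTransfer_eq hb φ hx, lsvTransfer_eq hb ψ hx, lsvTransfer_eq hb _ hx]
  have e : φ (lsvLeftInv b x) / branchP b x + φ ((x + 1) / 2) / 2 -
      (ψ (lsvLeftInv b x) / branchP b x + ψ ((x + 1) / 2) / 2) =
      (φ (lsvLeftInv b x) - ψ (lsvLeftInv b x)) / branchP b x +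
        (φ ((x + 1) / 2) - ψ ((x + 1) / 2)) / 2 := by ring
  rw [e]
  refine (abs_add_le _ _).trans_eq ?_
  rw [abs_div, abs_div, abs_of_pos (by linarith : 0 < branchP b x), abs_two]

lemma integral_transferComp_sub_antitone {β : ℤ → ℝ} (hβ : ∀ k, β k ∈ Ioo (0 : ℝ) 1) (j : ℤ)
    {φ ψ : ℝ → ℝ} (hφ : IntegrableOn φ (Ioc 0 1)) (hψ : IntegrableOn ψ (Ioc 0 1)) :
    Antitone fun n => ∫ t in Ioc 0 1, |transferComp β j n φ t - transferComp β j n ψ t| :=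
  antitone_nat_of_succ_le fun n => integral_lsvTransfer_sub_le (hβ _)
    (transferComp_integrableOn hβ j n hφ) (transferComp_integrableOn hβ j n hψ)

lemma transferComp_mem_unitConeStar {β : ℤ → ℝ} (hβ : ∀ k, β k ∈ Ioo (0 : ℝ) 1)
    (hC : ∀ k, MapsTo (lsvTransfer (β k)) (coneStar α a) (coneStar α a)) (j : ℤ) (n : ℕ)
    {φ : ℝ → ℝ} (hφ : φ ∈ unitConeStar α a) : transferComp β j n φ ∈ unitConeStar α a :=
  ⟨transferComp_mapsTo hC j n hφ.1, by rw [integral_transferComp hβ j n hφ.1.2.1, hφ.2]⟩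

/-- Loss of memory: the distance of the images of two densities of the cone tends to `0`,
uniformly over the two densities and over the initial time. -/
theorem exists_forall_integral_transferComp_sub_lt (hα : α ∈ Ioo (0 : ℝ) 1) {β : ℤ → ℝ}
    (hβ : ∀ k, β k ∈ Ioo (0 : ℝ) 1)
    (hC : ∀ k, MapsTo (lsvTransfer (β k)) (coneStar α a) (coneStar α a)) {ε : ℝ} (hε : 0 < ε) :
    ∃ M : ℕ, ∀ j, ∀ φ ∈ unitConeStar α a, ∀ ψ ∈ unitConeStar α a, ∀ n ≥ M,
      ∫ t in Ioc 0 1, |transferComp β j n φ t - transferComp β j n ψ t| < ε := by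
  obtain ⟨N, δ, hδ, hstep⟩ := exists_integral_transferComp_sub_le hα a hβ hε
  obtain ⟨K, hK⟩ := exists_nat_gt (2 / δ)
  rw [div_lt_iff₀ hδ] at hK
  refine ⟨N * K, fun j φ hφ ψ hψ n hn => ?_⟩
  refine (integral_transferComp_sub_antitone hβ j hφ.1.2.1 hψ.1.2.1 hn).trans_lt ?_
  have h2 : ∫ t in Ioc 0 1, |φ t - ψ t| ≤ 2 := by
    have h : ∫ t in Ioc 0 1, |φ t - ψ t| ≤ ∫ t in Ioc 0 1, (φ t + ψ t) := by
      refine setIntegral_mono_on (hφ.1.2.1.sub hψ.1.2.1).abs (hφ.1.2.1.add hψ.1.2.1)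
        measurableSet_Ioc fun t ht => ?_
      have h1 := hφ.1.2.2.1 t ht
      have h2 := hψ.1.2.2.1 t ht
      rw [abs_le]
      constructor <;> linarith
    rw [integral_add hφ.1.2.1 hψ.1.2.1, hφ.2, hψ.2] at h
    linarith
  have key : ∀ k : ℕ,
      ∫ t in Ioc 0 1, |transferComp β j (N * k) φ t - transferComp β j (N * k) ψ t| < ε ∨
      ∫ t in Ioc 0 1, |transferComp β j (N * k) φ t - transferComp β j (N * k) ψ t| ≤
        2 - k * δ := by
    intro k
    induction k with
    | zero => right; simpa [transferComp] using h2
    | succ k ih =>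
      have hanti := integral_transferComp_sub_antitone hβ j hφ.1.2.1 hψ.1.2.1
        (Nat.mul_le_mul_left N (Nat.le_succ k))
      rcases lt_or_ge (∫ t in Ioc 0 1,
        |transferComp β j (N * k) φ t - transferComp β j (N * k) ψ t|) ε with h | h
      · exact Or.inl (hanti.trans_lt h)
      · have h3 := ih.resolve_left (not_lt.2 h)
        right
        have h4 := hstep (j + (N * k : ℕ)) _ (transferComp_mem_unitConeStar hβ hC j (N * k) hφ) _
          (transferComp_mem_unitConeStar hβ hC j (N * k) hψ) h
        rw [← transferComp_add, ← transferComp_add, ← Nat.mul_succ] at h4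
        push_cast
        linarith
  refine (key K).resolve_right fun h => ?_
  have : 0 ≤ ∫ t in Ioc 0 1, |transferComp β j (N * K) φ t - transferComp β j (N * K) ψ t| :=
    integral_nonneg fun t => abs_nonneg _
  linarith

end MemoryLoss

/-! ### Euler derivatives along the inverse branches -/

/-- `φ₁` is the Euler derivative `x φ'(x)` of `φ` on `(0, 1]` (one-sided at the endpoint `1`). -/
def EulerDeriv (φ φ₁ : ℝ → ℝ) : Prop :=
  ∀ x ∈ Ioc (0 : ℝ) 1, HasDerivWithinAt φ (φ₁ x / x) (Ioc 0 1) x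

namespace EulerDeriv

variable {φ φ₁ ψ ψ₁ : ℝ → ℝ}

lemma continuousOn (h : EulerDeriv φ φ₁) : ContinuousOn φ (Ioc 0 1) :=
  fun x hx => (h x hx).continuousWithinAt

lemma congr (h : EulerDeriv φ φ₁) (h0 : EqOn ψ φ (Ioc 0 1)) (h1 : EqOn ψ₁ φ₁ (Ioc 0 1)) :
    EulerDeriv ψ ψ₁ := fun x hx => by
  rw [h1 hx]
  exact (h x hx).congr h0 (h0 hx)

lemma const (c : ℝ) : EulerDeriv (fun _ => c) (fun _ => 0) := fun x _ => by
  simpa using hasDerivWithinAt_const x (Ioc 0 1) c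

lemma add (h : EulerDeriv φ φ₁) (h' : EulerDeriv ψ ψ₁) :
    EulerDeriv (fun x => φ x + ψ x) (fun x => φ₁ x + ψ₁ x) := fun x hx => by
  rw [add_div]; exact (h x hx).add (h' x hx)

lemma mul (h : EulerDeriv φ φ₁) (h' : EulerDeriv ψ ψ₁) :
    EulerDeriv (fun x => φ x * ψ x) (fun x => φ₁ x * ψ x + φ x * ψ₁ x) := fun x hx =>
  ((h x hx).mul (h' x hx)).congr_deriv (by ring)

end EulerDeriv

/-- The Euler derivative `r = x g'(x) / g(x) = (1 + t) / p` of `log g`, where `g` is the inverse of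
the left branch; `1 - r = β t / p`. -/
noncomputable def branchR (β x : ℝ) : ℝ := (1 + branchT β x) * (branchP β x)⁻¹

/-- The functions of the parameter and the point that are polynomials in `β`, `t` and `1 / p`.
They are uniformly bounded, and the Euler derivative sends them to multiples of `β t`, which is
comparable to the contraction `1 - r` of the left branch. -/
inductive BranchCoeff : (ℝ → ℝ → ℝ) → Prop
  | const (c : ℝ) : BranchCoeff fun _ _ => c
  | param : BranchCoeff fun β _ => β
  | branchT : BranchCoeff branchT
  | inv_branchP : BranchCoeff fun β x => (branchP β x)⁻¹
  | add {w v : ℝ → ℝ → ℝ} : BranchCoeff w → BranchCoeff v → BranchCoeff fun β x => w β x + v β x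
  | mul {w v : ℝ → ℝ → ℝ} : BranchCoeff w → BranchCoeff v → BranchCoeff fun β x => w β x * v β x

section Branch

variable {β : ℝ}

lemma branchR_nonneg (hβ : β ∈ Ioo (0 : ℝ) 1) {x : ℝ} (hx : x ∈ Ioc (0 : ℝ) 1) :
    0 ≤ branchR β x := by
  have h1 := branchT_pos hβ hx
  have h2 := one_le_branchP hβ hx
  unfold branchR; positivity

lemma one_sub_branchR (hβ : β ∈ Ioo (0 : ℝ) 1) {x : ℝ} (hx : x ∈ Ioc (0 : ℝ) 1) :
    1 - branchR β x = β * branchT β x * (branchP β x)⁻¹ := by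
  have h2 := one_le_branchP hβ hx
  have h3 : branchP β x ≠ 0 := by linarith
  unfold branchR
  field_simp
  rw [branchP]; ring

lemma branchR_add_le_one (hβ : β ∈ Ioo (0 : ℝ) 1) {x : ℝ} (hx : x ∈ Ioc (0 : ℝ) 1) :
    branchR β x + β * branchT β x / 3 ≤ 1 := by
  have h1 := mul_pos hβ.1 (branchT_pos hβ hx)
  have h2 := one_le_branchP hβ hx
  have h3 : 1 / 3 ≤ (branchP β x)⁻¹ := by
    rw [← one_div]
    exact one_div_le_one_div_of_le (by linarith) (branchP_le_three hβ hx)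
  have h4 := mul_le_mul_of_nonneg_left h3 h1.le
  have h5 := one_sub_branchR hβ hx
  linarith

lemma EulerDeriv.comp_left (hβ : β ∈ Ioo (0 : ℝ) 1) {φ φ₁ : ℝ → ℝ} (h : EulerDeriv φ φ₁) :
    EulerDeriv (fun x => φ (lsvLeftInv β x))
      (fun x => branchR β x * φ₁ (lsvLeftInv β x)) := fun x hx => by
  have h1 := (h _ (lsvLeftInv_mapsTo hβ hx)).comp x (hasDerivWithinAt_lsvLeftInv hβ hx)
    (lsvLeftInv_mapsTo hβ)
  refine h1.congr_deriv ?_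
  have h2 := lsvLeftInv_mul hβ hx
  have h3 := lsvLeftInv_pos hβ hx
  have h4 := branchT_pos hβ hx
  have h5 := one_le_branchP hβ hx
  have h6 : branchP β x ≠ 0 := by linarith
  have h7 := hx.1
  unfold branchR
  field_simp
  linear_combination -φ₁ (lsvLeftInv β x) * h2

lemma EulerDeriv.comp_right {φ φ₁ : ℝ → ℝ} (h : EulerDeriv φ φ₁) :
    EulerDeriv (fun x => φ ((x + 1) / 2)) (fun x => x / (x + 1) * φ₁ ((x + 1) / 2)) :=
    fun x hx => by
  have h0 : HasDerivWithinAt (fun x : ℝ => (x + 1) / 2) (1 / 2) (Ioc 0 1) x :=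
    (((hasDerivAt_id x).add_const 1).div_const 2).hasDerivWithinAt
  have h1 := (h _ (right_mapsTo hx)).comp x h0 right_mapsTo
  refine h1.congr_deriv ?_
  have h7 := hx.1
  field_simp

lemma eulerDeriv_branchT (hβ : β ∈ Ioo (0 : ℝ) 1) :
    EulerDeriv (branchT β) (fun x => β * branchT β x * branchR β x) := by
  have h : EulerDeriv (fun y => (2 * y) ^ β) (fun y => β * (2 * y) ^ β) := fun y hy => by
    have h2y : (0 : ℝ) < 2 * y := by linarith [hy.1]
    have h1 := (((hasDerivAt_id y).const_mul 2).rpow_const (p := β)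
      (Or.inl h2y.ne')).hasDerivWithinAt (s := Ioc 0 1)
    refine h1.congr_deriv ?_
    have := hy.1
    simp only [id, Real.rpow_sub_one h2y.ne']
    field_simp
  exact (h.comp_left hβ).congr (fun x _ => rfl) fun x _ => by simp only [branchT]; ring

lemma eulerDeriv_inv_branchP (hβ : β ∈ Ioo (0 : ℝ) 1) :
    EulerDeriv (fun x => (branchP β x)⁻¹) (fun x => β * branchT β x *
      (-(β + 1) * branchR β x * (branchP β x)⁻¹ * (branchP β x)⁻¹)) := fun x hx => by
  have h1 := ((eulerDeriv_branchT hβ x hx).const_mul (β + 1)).const_add 1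
  have h2 := one_le_branchP hβ hx
  have h3 : branchP β x ≠ 0 := by linarith
  refine (h1.inv h3).congr_deriv ?_
  change _ / branchP β x ^ 2 = _
  have := hx.1
  field_simp

lemma BranchCoeff.branchR : BranchCoeff branchR :=
  ((BranchCoeff.const 1).add BranchCoeff.branchT).mul BranchCoeff.inv_branchP

lemma BranchCoeff.exists_bound {w : ℝ → ℝ → ℝ} (hw : BranchCoeff w) :
    ∃ C, ∀ β ∈ Ioo (0 : ℝ) 1, ∀ x ∈ Ioc (0 : ℝ) 1, |w β x| ≤ C := by
  induction hw with
  | const c => exact ⟨|c|, fun _ _ _ _ => le_rfl⟩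
  | param => exact ⟨1, fun β hβ _ _ => by rw [abs_of_pos hβ.1]; exact hβ.2.le⟩
  | branchT =>
    exact ⟨1, fun β hβ x hx => by rw [abs_of_pos (branchT_pos hβ hx)]; exact branchT_le_one hβ hx⟩
  | inv_branchP =>
    refine ⟨1, fun β hβ x hx => ?_⟩
    have := one_le_branchP hβ hx
    rw [abs_of_pos (by positivity)]
    exact inv_le_one_of_one_le₀ this
  | add _ _ ih ih' =>
    obtain ⟨C, hC⟩ := ih
    obtain ⟨C', hC'⟩ := ih'
    exact ⟨C + C', fun β hβ x hx =>
      (abs_add_le _ _).trans (add_le_add (hC β hβ x hx) (hC' β hβ x hx))⟩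
  | mul _ _ ih ih' =>
    obtain ⟨C, hC⟩ := ih
    obtain ⟨C', hC'⟩ := ih'
    refine ⟨C * C', fun β hβ x hx => ?_⟩
    rw [abs_mul]
    exact mul_le_mul (hC β hβ x hx) (hC' β hβ x hx) (abs_nonneg _)
      ((abs_nonneg _).trans (hC β hβ x hx))

lemma BranchCoeff.exists_eulerDeriv {w : ℝ → ℝ → ℝ} (hw : BranchCoeff w) :
    ∃ w₁, BranchCoeff w₁ ∧ ∀ β ∈ Ioo (0 : ℝ) 1,
      EulerDeriv (w β) (fun x => β * _root_.branchT β x * w₁ β x) := by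
  induction hw with
  | const c =>
    exact ⟨_, .const 0, fun β _ => (EulerDeriv.const c).congr (fun _ _ => rfl)
      fun _ _ => by simp⟩
  | param =>
    exact ⟨_, .const 0, fun β _ => (EulerDeriv.const β).congr (fun _ _ => rfl)
      fun _ _ => by simp⟩
  | branchT => exact ⟨_, .branchR, fun β hβ => eulerDeriv_branchT hβ⟩
  | inv_branchP =>
    refine ⟨fun β x => -1 * (β + 1) * _root_.branchR β x * (branchP β x)⁻¹ * (branchP β x)⁻¹,
      ((((BranchCoeff.const (-1)).mul (BranchCoeff.param.add (.const 1))).mul .branchR).mul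
        .inv_branchP).mul .inv_branchP, fun β hβ => ?_⟩
    exact (eulerDeriv_inv_branchP hβ).congr (fun _ _ => rfl) fun _ _ => by simp only; ring
  | @add w v _ _ ih ih' =>
    obtain ⟨w₁, hw₁, h⟩ := ih
    obtain ⟨v₁, hv₁, h'⟩ := ih'
    exact ⟨_, hw₁.add hv₁, fun β hβ => ((h β hβ).add (h' β hβ)).congr (fun _ _ => rfl)
      fun _ _ => by simp only; ring⟩
  | @mul w v hw hv ih ih' =>
    obtain ⟨w₁, hw₁, h⟩ := ih
    obtain ⟨v₁, hv₁, h'⟩ := ih'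
    exact ⟨_, (hw₁.mul hv).add (hw.mul hv₁), fun β hβ => ((h β hβ).mul (h' β hβ)).congr
      (fun _ _ => rfl) fun _ _ => by simp only; ring⟩

lemma BranchCoeff.continuousOn {w : ℝ → ℝ → ℝ} (hw : BranchCoeff w) (hβ : β ∈ Ioo (0 : ℝ) 1) :
    ContinuousOn (w β) (Ioc 0 1) := by
  obtain ⟨w₁, -, h⟩ := hw.exists_eulerDeriv
  exact (h β hβ).continuousOn

/-- The Euler derivative of a weighted composition `p⁻¹ w · φ ∘ g`: the derivative falls on `φ` with
the factor `r`, up to a term of size `β t`. -/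
lemma BranchCoeff.exists_eulerDeriv_comp {w : ℝ → ℝ → ℝ} (hw : BranchCoeff w) :
    ∃ w', BranchCoeff w' ∧ ∀ β ∈ Ioo (0 : ℝ) 1, ∀ φ φ₁ : ℝ → ℝ, EulerDeriv φ φ₁ →
      EulerDeriv (fun x => (branchP β x)⁻¹ * (w β x * φ (lsvLeftInv β x)))
        (fun x => (branchP β x)⁻¹ * (β * _root_.branchT β x * (w' β x * φ (lsvLeftInv β x)) +
          w β x * (_root_.branchR β x * φ₁ (lsvLeftInv β x)))) := by
  obtain ⟨w₁, hw₁, h⟩ := hw.exists_eulerDeriv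
  refine ⟨fun β x => -1 * (β + 1) * _root_.branchR β x * (branchP β x)⁻¹ * w β x + w₁ β x,
    (((((BranchCoeff.const (-1)).mul (BranchCoeff.param.add (.const 1))).mul .branchR).mul
        .inv_branchP).mul hw).add hw₁, fun β hβ φ φ₁ hφ => ?_⟩
  exact ((eulerDeriv_inv_branchP hβ).mul ((h β hβ).mul (hφ.comp_left hβ))).congr
    (fun _ _ => rfl) fun x _ => by simp only; ring

/-- The first three Euler derivatives of the left part `p⁻¹ · φ ∘ g` of the transfer operator. -/
lemma exists_eulerDeriv_left :
    ∃ c₁₀ c₂₀ c₂₁ c₃₀ c₃₁ c₃₂ : ℝ → ℝ → ℝ,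
      (BranchCoeff c₁₀ ∧ BranchCoeff c₂₀ ∧ BranchCoeff c₂₁ ∧ BranchCoeff c₃₀ ∧
        BranchCoeff c₃₁ ∧ BranchCoeff c₃₂) ∧
      ∀ β ∈ Ioo (0 : ℝ) 1, ∀ φ φ₁ : ℝ → ℝ, EulerDeriv φ φ₁ →
        EulerDeriv (fun x => (branchP β x)⁻¹ * φ (lsvLeftInv β x))
          (fun x => (branchP β x)⁻¹ * (branchR β x * φ₁ (lsvLeftInv β x) +
            β * branchT β x * (c₁₀ β x * φ (lsvLeftInv β x)))) ∧
        ∀ φ₂ : ℝ → ℝ, EulerDeriv φ₁ φ₂ →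
          EulerDeriv (fun x => (branchP β x)⁻¹ * (branchR β x * φ₁ (lsvLeftInv β x) +
              β * branchT β x * (c₁₀ β x * φ (lsvLeftInv β x))))
            (fun x => (branchP β x)⁻¹ * (branchR β x ^ 2 * φ₂ (lsvLeftInv β x) +
              β * branchT β x * (c₂₀ β x * φ (lsvLeftInv β x) +
                c₂₁ β x * φ₁ (lsvLeftInv β x)))) ∧
          ∀ φ₃ : ℝ → ℝ, EulerDeriv φ₂ φ₃ →
            EulerDeriv (fun x => (branchP β x)⁻¹ * (branchR β x ^ 2 * φ₂ (lsvLeftInv β x) +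
                β * branchT β x * (c₂₀ β x * φ (lsvLeftInv β x) +
                  c₂₁ β x * φ₁ (lsvLeftInv β x))))
              (fun x => (branchP β x)⁻¹ * (branchR β x ^ 3 * φ₃ (lsvLeftInv β x) +
                β * branchT β x * (c₃₀ β x * φ (lsvLeftInv β x) +
                  c₃₁ β x * φ₁ (lsvLeftInv β x) + c₃₂ β x * φ₂ (lsvLeftInv β x)))) := by
  have hbt : BranchCoeff fun β x => β * branchT β x := BranchCoeff.param.mul .branchT
  obtain ⟨a₀, ha₀, Ha⟩ := (BranchCoeff.const 1).exists_eulerDeriv_comp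
  obtain ⟨b₁, hb₁, Hb₁⟩ := BranchCoeff.branchR.exists_eulerDeriv_comp
  obtain ⟨b₀, hb₀, Hb₀⟩ := (hbt.mul ha₀).exists_eulerDeriv_comp
  have hc₂₁ : BranchCoeff fun β x => b₁ β x + a₀ β x * branchR β x :=
    hb₁.add (ha₀.mul .branchR)
  obtain ⟨d₂, hd₂, Hd₂⟩ := (BranchCoeff.branchR.mul .branchR).exists_eulerDeriv_comp
  obtain ⟨d₁, hd₁, Hd₁⟩ := (hbt.mul hc₂₁).exists_eulerDeriv_comp
  obtain ⟨d₀, hd₀, Hd₀⟩ := (hbt.mul hb₀).exists_eulerDeriv_comp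
  refine ⟨a₀, b₀, _, d₀, _, _, ⟨ha₀, hb₀, hc₂₁, hd₀, hd₁.add (hb₀.mul .branchR),
    hd₂.add (hc₂₁.mul .branchR)⟩, fun β hβ φ φ₁ h₁ => ⟨?_, fun φ₂ h₂ => ⟨?_, fun φ₃ h₃ => ?_⟩⟩⟩
  · exact (Ha β hβ φ φ₁ h₁).congr (fun _ _ => by simp) fun _ _ => by simp only; ring
  · exact ((Hb₁ β hβ φ₁ φ₂ h₂).add (Hb₀ β hβ φ φ₁ h₁)).congr
      (fun _ _ => by simp only; ring) fun _ _ => by simp only; ring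
  · exact (((Hd₂ β hβ φ₂ φ₃ h₃).add (Hd₁ β hβ φ₁ φ₂ h₂)).add (Hd₀ β hβ φ φ₁ h₁)).congr
      (fun _ _ => by simp only; ring) fun _ _ => by simp only; ring

lemma eulerDeriv_div_add_one :
    EulerDeriv (fun x => x / (x + 1)) (fun x => x / (x + 1) * (1 - x / (x + 1))) := fun x hx => by
  have h := hx.1
  have h1 := ((hasDerivAt_id x).div ((hasDerivAt_id x).add_const 1)
    (by simp only [id]; linarith)).hasDerivWithinAt (s := Ioc 0 1)
  refine h1.congr_deriv ?_
  simp only [id]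
  field_simp

/-- The first Euler derivative of the right part of the transfer operator. -/
lemma EulerDeriv.right_one {φ φ₁ : ℝ → ℝ} (h₁ : EulerDeriv φ φ₁) :
    EulerDeriv (fun x => 1 / 2 * φ ((x + 1) / 2))
      (fun x => 1 / 2 * (x / (x + 1) * φ₁ ((x + 1) / 2))) :=
  ((EulerDeriv.const (1 / 2)).mul h₁.comp_right).congr (fun _ _ => rfl)
    fun _ _ => by simp only; ring

/-- The second Euler derivative of the right part of the transfer operator. -/
lemma EulerDeriv.right_two {φ₁ φ₂ : ℝ → ℝ} (h₂ : EulerDeriv φ₁ φ₂) :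
    EulerDeriv (fun x => 1 / 2 * (x / (x + 1) * φ₁ ((x + 1) / 2)))
      (fun x => 1 / 2 * ((x / (x + 1)) ^ 2 * φ₂ ((x + 1) / 2) +
        x / (x + 1) * (1 - x / (x + 1)) * φ₁ ((x + 1) / 2))) :=
  ((EulerDeriv.const (1 / 2)).mul (eulerDeriv_div_add_one.mul h₂.comp_right)).congr
    (fun _ _ => rfl) fun _ _ => by simp only; ring

/-- The third Euler derivative of the right part of the transfer operator. -/
lemma EulerDeriv.right_three {φ₁ φ₂ φ₃ : ℝ → ℝ} (h₂ : EulerDeriv φ₁ φ₂) (h₃ : EulerDeriv φ₂ φ₃) :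
    EulerDeriv (fun x => 1 / 2 * ((x / (x + 1)) ^ 2 * φ₂ ((x + 1) / 2) +
        x / (x + 1) * (1 - x / (x + 1)) * φ₁ ((x + 1) / 2)))
      (fun x => 1 / 2 * ((x / (x + 1)) ^ 3 * φ₃ ((x + 1) / 2) +
        3 * ((x / (x + 1)) ^ 2 * (1 - x / (x + 1))) * φ₂ ((x + 1) / 2) +
        x / (x + 1) * (1 - x / (x + 1)) * (1 - 2 * (x / (x + 1))) * φ₁ ((x + 1) / 2))) := by
  have hd := eulerDeriv_div_add_one
  have hd' := (EulerDeriv.const 1).add ((EulerDeriv.const (-1)).mul hd)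
  exact ((EulerDeriv.const (1 / 2)).mul (((hd.mul hd).mul h₃.comp_right).add
    ((hd.mul hd').mul h₂.comp_right))).congr (fun _ _ => by simp only; ring)
    fun _ _ => by simp only; ring

lemma div_add_one_mem {x : ℝ} (hx : x ∈ Ioc (0 : ℝ) 1) : x / (x + 1) ∈ Icc (0 : ℝ) (1 / 2) := by
  have := hx.1
  refine ⟨by positivity, ?_⟩
  rw [div_le_iff₀ (by linarith)]
  linarith [hx.2]

/-- The transfer operator is the sum of its left and right parts, hence so are its derivatives. -/
lemma EulerDeriv.lsvTransfer (hβ : β ∈ Ioo (0 : ℝ) 1) {φ ψ₁ ψ₁' : ℝ → ℝ}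
    (h : EulerDeriv (fun x => (branchP β x)⁻¹ * φ (lsvLeftInv β x)) ψ₁)
    (h' : EulerDeriv (fun x => 1 / 2 * φ ((x + 1) / 2)) ψ₁') :
    EulerDeriv (lsvTransfer β φ) (fun x => ψ₁ x + ψ₁' x) :=
  (h.add h').congr (fun x hx => by rw [lsvTransfer_eq hβ φ hx]; ring) fun _ _ => rfl

/-- The contraction of the left branch absorbs perturbations of relative size `β t`. -/
lemma branchR_pow_mul_add_le (hβ : β ∈ Ioo (0 : ℝ) 1) {x : ℝ} (hx : x ∈ Ioc (0 : ℝ) 1)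
    {k : ℕ} (hk : k ≠ 0) {B C : ℝ} (hB : 0 ≤ B) (hC : 3 * C ≤ B) :
    branchR β x ^ k * B + β * branchT β x * C ≤ B := by
  have h0 := branchR_nonneg hβ hx
  have h1 := branchR_add_le_one hβ hx
  have h2 := mul_pos hβ.1 (branchT_pos hβ hx)
  have h3 : branchR β x ^ k ≤ branchR β x := pow_le_of_le_one h0 (by linarith) hk
  nlinarith [mul_le_mul_of_nonneg_right h3 hB]

end Branch

/-! ### Invariance of the cones defined by derivatives -/

section DerivativeCones

variable {β b₁ b₂ : ℝ}

/-- The bound `B` on a derivative survives the left branch when the coefficient `D` of the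
perturbation is at most `B / 3` times the function. -/
lemma abs_left_le (hβ : β ∈ Ioo (0 : ℝ) 1) {x : ℝ} (hx : x ∈ Ioc (0 : ℝ) 1) {k : ℕ} (hk : k ≠ 0)
    {B C A D f : ℝ} (hB : 0 ≤ B) (hC : 3 * C ≤ B) (hf : 0 ≤ f) (hA : |A| ≤ B * f)
    (hD : |D| ≤ C * f) :
    |(branchP β x)⁻¹ * (branchR β x ^ k * A + β * branchT β x * D)| ≤
      B * ((branchP β x)⁻¹ * f) := by
  have h1 := one_le_branchP hβ hx
  have h2 : 0 ≤ (branchP β x)⁻¹ := by positivity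
  have h3 := pow_nonneg (branchR_nonneg hβ hx) k
  have h4 := (mul_pos hβ.1 (branchT_pos hβ hx)).le
  have h5 : |branchR β x ^ k * A + β * branchT β x * D| ≤ B * f := by
    refine (abs_add_le _ _).trans ?_
    rw [abs_mul, abs_mul, abs_of_nonneg h3, abs_of_nonneg h4]
    have h6 := mul_le_mul_of_nonneg_left hA h3
    have h7 := mul_le_mul_of_nonneg_left hD h4
    have h8 := mul_le_mul_of_nonneg_right (branchR_pow_mul_add_le hβ hx hk hB hC) hf
    linarith
  rw [abs_mul, abs_of_nonneg h2]
  linarith [mul_le_mul_of_nonneg_left h5 h2]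

lemma contDiffOn_two_of_hasDerivWithinAt {u v w : ℝ → ℝ}
    (hu : ∀ x ∈ Ioc (0 : ℝ) 1, HasDerivWithinAt u (v x) (Ioc 0 1) x)
    (hv : ∀ x ∈ Ioc (0 : ℝ) 1, HasDerivWithinAt v (w x) (Ioc 0 1) x)
    (hw : ContinuousOn w (Ioc 0 1)) :
    ContDiffOn ℝ 2 u (Ioc 0 1) ∧ ∀ x ∈ Ioc (0 : ℝ) 1, derivWithin u (Ioc 0 1) x = v x ∧
      iteratedDerivWithin 2 u (Ioc 0 1) x = w x := by
  have hU := uniqueDiffOn_Ioc (0 : ℝ) 1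
  have e1 : EqOn (derivWithin u (Ioc 0 1)) v (Ioc 0 1) :=
    fun x hx => (hu x hx).derivWithin (hU x hx)
  have e2 : EqOn (derivWithin v (Ioc 0 1)) w (Ioc 0 1) :=
    fun x hx => (hv x hx).derivWithin (hU x hx)
  have hv1 : ContDiffOn ℝ 1 v (Ioc 0 1) := by
    rw [show (1 : WithTop ℕ∞) = 0 + 1 by simp, contDiffOn_succ_iff_derivWithin hU]
    exact ⟨fun x hx => (hv x hx).differentiableWithinAt, by simp,
      contDiffOn_zero.2 (hw.congr e2)⟩
  refine ⟨?_, fun x hx => ⟨e1 hx, ?_⟩⟩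
  · rw [show (2 : WithTop ℕ∞) = 1 + 1 by norm_num, contDiffOn_succ_iff_derivWithin hU]
    exact ⟨fun x hx => (hu x hx).differentiableWithinAt, by simp, hv1.congr e1⟩
  · rw [iteratedDerivWithin_succ, derivWithin_congr (f := v) ?_ ?_, e2 hx]
    · intro y hy; rw [iteratedDerivWithin_one, e1 hy]
    · rw [iteratedDerivWithin_one, e1 hx]

/-- First and second derivatives in terms of the Euler derivatives. -/
lemma EulerDeriv.hasDerivWithinAt_div {φ₁ φ₂ : ℝ → ℝ} (h : EulerDeriv φ₁ φ₂) {x : ℝ}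
    (hx : x ∈ Ioc (0 : ℝ) 1) :
    HasDerivWithinAt (fun x => φ₁ x / x) ((φ₂ x - φ₁ x) / x ^ 2) (Ioc 0 1) x := by
  have h0 := hx.1
  refine ((h x hx).div (hasDerivWithinAt_id x _) h0.ne').congr_deriv ?_
  simp only [id]
  field_simp

lemma mem_coneTwo_of_eulerDeriv {φ φ₁ φ₂ : ℝ → ℝ} (h₁ : EulerDeriv φ φ₁) (h₂ : EulerDeriv φ₁ φ₂)
    (hc : ContinuousOn φ₂ (Ioc 0 1)) (hb : ∀ x ∈ Ioc (0 : ℝ) 1,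
      0 ≤ φ x ∧ |φ₁ x| ≤ b₁ * φ x ∧ |φ₂ x - φ₁ x| ≤ b₂ * φ x) : φ ∈ coneTwo b₁ b₂ := by
  have hcont : ContinuousOn (fun x => (φ₂ x - φ₁ x) / x ^ 2) (Ioc 0 1) :=
    (hc.sub h₂.continuousOn).div (by fun_prop) fun x hx => (pow_pos hx.1 2).ne'
  obtain ⟨hC, hd⟩ := contDiffOn_two_of_hasDerivWithinAt h₁ (fun x hx => h₂.hasDerivWithinAt_div hx)
    hcont
  refine ⟨hC, fun x hx => ?_⟩
  obtain ⟨hx0, hx1, hx2⟩ := hb x hx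
  have h0 := hx.1
  rw [(hd x hx).1, (hd x hx).2, abs_div, abs_div, abs_of_pos h0, abs_of_pos (pow_pos h0 2),
    div_mul_eq_mul_div, div_mul_eq_mul_div]
  exact ⟨hx0, by gcongr, by gcongr⟩

lemma exists_eulerDeriv_of_mem_coneTwo {φ : ℝ → ℝ} (hφ : φ ∈ coneTwo b₁ b₂) :
    ∃ φ₁ φ₂, EulerDeriv φ φ₁ ∧ EulerDeriv φ₁ φ₂ ∧ ContinuousOn φ₂ (Ioc 0 1) ∧
      ∀ x ∈ Ioc (0 : ℝ) 1, 0 ≤ φ x ∧ |φ₁ x| ≤ b₁ * φ x ∧ |φ₂ x - φ₁ x| ≤ b₂ * φ x := by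
  obtain ⟨hC, hb⟩ := hφ
  have hU := uniqueDiffOn_Ioc (0 : ℝ) 1
  have hd : ∀ x ∈ Ioc (0 : ℝ) 1,
      HasDerivWithinAt φ (derivWithin φ (Ioc 0 1) x) (Ioc 0 1) x := fun x hx =>
    (hC.differentiableOn (by norm_num) x hx).hasDerivWithinAt
  rw [show (2 : WithTop ℕ∞) = 1 + 1 by norm_num, contDiffOn_succ_iff_derivWithin hU] at hC
  have hd2 : ∀ x ∈ Ioc (0 : ℝ) 1, HasDerivWithinAt (derivWithin φ (Ioc 0 1))
      (iteratedDerivWithin 2 φ (Ioc 0 1) x) (Ioc 0 1) x := fun x hx => by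
    have := (hC.2.2.differentiableOn (by norm_num) x hx).hasDerivWithinAt
    rwa [iteratedDerivWithin_succ, iteratedDerivWithin_one]
  have hcont : ContinuousOn (iteratedDerivWithin 2 φ (Ioc 0 1)) (Ioc 0 1) := by
    rw [iteratedDerivWithin_succ', iteratedDerivWithin_one]
    exact hC.2.2.continuousOn_derivWithin hU le_rfl
  refine ⟨fun x => x * derivWithin φ (Ioc 0 1) x,
    fun x => x * derivWithin φ (Ioc 0 1) x + x ^ 2 * iteratedDerivWithin 2 φ (Ioc 0 1) x,
    fun x hx => ?_, fun x hx => ?_, ?_, fun x hx => ?_⟩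
  · have := hx.1
    exact (hd x hx).congr_deriv (by field_simp)
  · have := hx.1
    refine ((hasDerivWithinAt_id x _).mul (hd2 x hx)).congr_deriv ?_
    simp only [id]
    field_simp
  · exact (continuousOn_id.mul fun x hx => (hd2 x hx).continuousWithinAt).add
      ((continuousOn_pow 2).mul hcont)
  · obtain ⟨h0, h1, h2⟩ := hb x hx
    have hx0 := hx.1
    rw [div_mul_eq_mul_div, le_div_iff₀ hx0] at h1
    rw [div_mul_eq_mul_div, le_div_iff₀ (pow_pos hx0 2)] at h2
    refine ⟨h0, ?_, ?_⟩
    · rw [abs_mul, abs_of_pos hx0]; linarith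
    · rw [add_sub_cancel_left, abs_mul, abs_of_pos (pow_pos hx0 2)]; linarith

lemma abs_mul_le_of_abs_le {c C A B f : ℝ} (hc : |c| ≤ C) (hA : |A| ≤ B * f) :
    |c * A| ≤ C * B * f := by
  rw [abs_mul, mul_assoc]
  exact mul_le_mul hc hA (abs_nonneg _) ((abs_nonneg _).trans hc)

lemma mul_lsvTransfer_eq (hβ : β ∈ Ioo (0 : ℝ) 1) (B : ℝ) (φ : ℝ → ℝ) {x : ℝ}
    (hx : x ∈ Ioc (0 : ℝ) 1) : B * lsvTransfer β φ x =
      B * ((branchP β x)⁻¹ * φ (lsvLeftInv β x)) + B * (2⁻¹ * φ ((x + 1) / 2)) := by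
  rw [lsvTransfer_eq hβ φ hx]; ring

/-- The cone `C_2(b₁, b₂)` is invariant for suitable `b₁` and `b₂`, uniformly over all parameters
in `(0, 1)`. -/
theorem exists_lsvTransfer_mapsTo_coneTwo : ∃ b₁ b₂ : ℝ, 0 < b₁ ∧ 0 < b₂ ∧
    ∀ β ∈ Ioo (0 : ℝ) 1, MapsTo (lsvTransfer β) (coneTwo b₁ b₂) (coneTwo b₁ b₂) := by
  obtain ⟨c₁₀, c₂₀, c₂₁, c₃₀, c₃₁, c₃₂, ⟨h₁₀, h₂₀, h₂₁, -, -, -⟩, H⟩ := exists_eulerDeriv_left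
  obtain ⟨C₁, hC₁⟩ := h₁₀.exists_bound
  obtain ⟨D₀, hD₀⟩ :=
    (h₂₀.add ((BranchCoeff.const (-1)).mul h₁₀)).exists_bound
  obtain ⟨D₁, hD₁⟩ :=
    (h₂₁.add ((BranchCoeff.const (-1)).mul (BranchCoeff.branchR.mul .inv_branchP))).exists_bound
  set b₁ := 3 * |C₁| + 1
  set b₂ := 3 * (|D₀| + |D₁| * b₁) + 1
  have hb₁ : 0 < b₁ := by positivity
  have hb₂ : 0 < b₂ := by positivity
  refine ⟨b₁, b₂, hb₁, hb₂, fun β hβ φ hφ => ?_⟩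
  obtain ⟨φ₁, φ₂, h₁, h₂, hc, hb⟩ := exists_eulerDeriv_of_mem_coneTwo hφ
  obtain ⟨L₁, H⟩ := H β hβ φ φ₁ h₁
  obtain ⟨L₂, -⟩ := H φ₂ h₂
  refine mem_coneTwo_of_eulerDeriv (EulerDeriv.lsvTransfer hβ L₁ h₁.right_one)
    (L₂.add h₂.right_two) ?_ fun x hx => ⟨lsvTransfer_nonneg hβ (fun x hx => (hb x hx).1) x hx, ?_⟩
  · have hg : ContinuousOn (lsvLeftInv β) (Ioc 0 1) :=
      (lsvLeftInv_continuousOn hβ).mono Ioc_subset_Icc_self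
    have hm := lsvLeftInv_mapsTo hβ
    have hq : ContinuousOn (fun x : ℝ => (x + 1) / 2) (Ioc 0 1) := by fun_prop
    have hρ := eulerDeriv_div_add_one.continuousOn
    refine ContinuousOn.add ?_ ?_
    · exact (BranchCoeff.inv_branchP.continuousOn hβ).mul
        (((BranchCoeff.branchR.continuousOn hβ).pow 2).mul (hc.comp hg hm) |>.add
          ((BranchCoeff.param.mul .branchT).continuousOn hβ |>.mul
            (((h₂₀.continuousOn hβ).mul (h₁.continuousOn.comp hg hm)).add
              ((h₂₁.continuousOn hβ).mul (h₂.continuousOn.comp hg hm)))))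
    · exact continuousOn_const.mul (((hρ.pow 2).mul (hc.comp hq right_mapsTo)).add
        ((hρ.mul (continuousOn_const.sub hρ)).mul (h₂.continuousOn.comp hq right_mapsTo)))
  · obtain ⟨p0, p1, p2⟩ := hb _ (lsvLeftInv_mapsTo hβ hx)
    obtain ⟨q0, q1, q2⟩ := hb _ (right_mapsTo hx)
    simp only at q0 q1 q2
    have hρ := div_add_one_mem hx
    have hr := one_sub_branchR hβ hx
    rw [mul_lsvTransfer_eq hβ _ φ hx, mul_lsvTransfer_eq hβ _ φ hx]
    set ρ := x / (x + 1)
    set g := lsvLeftInv β x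
    constructor
    · refine (abs_add_le _ _).trans (add_le_add ?_ ?_)
      · have := abs_left_le hβ hx one_ne_zero hb₁.le (show 3 * |C₁| ≤ b₁ by simp [b₁]) p0 p1
          (D := c₁₀ β x * φ g) (by
            rw [abs_mul]
            exact mul_le_mul ((hC₁ β hβ x hx).trans (le_abs_self _)) (abs_of_nonneg p0).le
              (abs_nonneg _) (abs_nonneg _))
        rwa [pow_one] at this
      · rw [abs_mul, abs_mul, abs_of_nonneg hρ.1, abs_of_pos (by norm_num : (0 : ℝ) < 1 / 2)]
        nlinarith [abs_nonneg (φ₁ ((x + 1) / 2)), hρ.1, hρ.2]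
    · have hD : |(c₂₀ β x + -1 * c₁₀ β x) * φ g +
          (c₂₁ β x + -1 * (branchR β x * (branchP β x)⁻¹)) * φ₁ g| ≤
          (|D₀| + |D₁| * b₁) * φ g := by
        refine (abs_add_le _ _).trans ?_
        have e1 := abs_mul_le_of_abs_le ((hD₀ β hβ x hx).trans (le_abs_self _))
          (B := 1) (f := φ g) (A := φ g) (by rw [abs_of_nonneg p0, one_mul])
        have e2 := abs_mul_le_of_abs_le ((hD₁ β hβ x hx).trans (le_abs_self _)) p1
        linarith
      have hL := abs_left_le hβ hx two_ne_zero hb₂.le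
        (show 3 * (|D₀| + |D₁| * b₁) ≤ b₂ by simp [b₂]) p0 p2 hD
      have hR : |1 / 2 * (ρ ^ 2 * (φ₂ ((x + 1) / 2) - φ₁ ((x + 1) / 2)))| ≤
          b₂ * (2⁻¹ * φ ((x + 1) / 2)) := by
        rw [abs_mul, abs_mul, abs_of_nonneg (sq_nonneg ρ),
          abs_of_pos (by norm_num : (0 : ℝ) < 1 / 2)]
        have : ρ ^ 2 ≤ 1 := pow_le_one₀ hρ.1 (by linarith [hρ.2])
        nlinarith [abs_nonneg (φ₂ ((x + 1) / 2) - φ₁ ((x + 1) / 2))]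
      -- `r² φ₂ - r φ₁ = r² (φ₂ - φ₁) - r (1 - r) φ₁`, and `1 - r` is a multiple of `β t`
      refine (le_of_eq ?_).trans ((abs_add_le _ _).trans (add_le_add hL hR))
      congr 1
      linear_combination -(branchP β x)⁻¹ * branchR β x * φ₁ g * hr

/-- The functions with three Euler derivatives that are bounded by multiples of the function
itself. The bound on the third one makes the second derivatives equicontinuous, so that the
limits of the densities are twice continuously differentiable. -/
def coneThree (B₁ B₂ B₃ : ℝ) : Set (ℝ → ℝ) :=
  {φ | ∃ φ₁ φ₂ φ₃, EulerDeriv φ φ₁ ∧ EulerDeriv φ₁ φ₂ ∧ EulerDeriv φ₂ φ₃ ∧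
    ∀ x ∈ Ioc (0 : ℝ) 1, 0 ≤ φ x ∧ |φ₁ x| ≤ B₁ * φ x ∧ |φ₂ x| ≤ B₂ * φ x ∧ |φ₃ x| ≤ B₃ * φ x}

lemma right_weight_bounds {ρ : ℝ} (h0 : 0 ≤ ρ) (h1 : ρ ≤ 1 / 2) :
    |ρ| ≤ 1 ∧ |ρ * (1 - ρ)| ≤ 1 / 2 ∧ |ρ ^ 2| ≤ 1 / 4 ∧ |ρ ^ 3| ≤ 1 / 4 ∧
      |3 * (ρ ^ 2 * (1 - ρ))| ≤ 3 / 4 ∧ |ρ * (1 - ρ) * (1 - 2 * ρ)| ≤ 1 / 2 := by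
  have hsq : ρ ^ 2 ≤ 1 / 4 := by nlinarith
  have hsq0 := sq_nonneg ρ
  have h2 : 0 ≤ ρ * (1 - ρ) := mul_nonneg h0 (by linarith)
  have h3 : ρ * (1 - ρ) ≤ 1 / 2 := by linarith
  have h4 : ρ ^ 3 ≤ 1 / 4 := by
    rw [pow_succ]
    exact (mul_le_of_le_one_right hsq0 (by linarith)).trans hsq
  have h5 : ρ ^ 2 * (1 - ρ) ≤ 1 / 4 := (mul_le_of_le_one_right hsq0 (by linarith)).trans hsq
  have h6 : 0 ≤ ρ ^ 2 * (1 - ρ) := mul_nonneg hsq0 (by linarith)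
  rw [abs_of_nonneg h0, abs_of_nonneg h2, abs_of_nonneg hsq0, abs_of_nonneg (pow_nonneg h0 3),
    abs_of_nonneg (by linarith), abs_of_nonneg (mul_nonneg h2 (by linarith))]
  exact ⟨by linarith, h3, hsq, h4, by linarith,
    (mul_le_of_le_one_right h2 (by linarith)).trans h3⟩

/-- The bounds are chosen successively: `Bᵢ` dominates the lower order terms, which involve only
the `Bⱼ` with `j < i`. -/
lemma exists_lsvTransfer_mapsTo_coneThree : ∃ B₁ B₂ B₃ : ℝ, 0 < B₁ ∧ 0 < B₂ ∧ 0 < B₃ ∧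
    ∀ β ∈ Ioo (0 : ℝ) 1, MapsTo (lsvTransfer β) (coneThree B₁ B₂ B₃) (coneThree B₁ B₂ B₃) := by
  obtain ⟨c₁₀, c₂₀, c₂₁, c₃₀, c₃₁, c₃₂, ⟨h₁₀, h₂₀, h₂₁, h₃₀, h₃₁, h₃₂⟩, H⟩ :=
    exists_eulerDeriv_left
  obtain ⟨C₁₀, hC₁₀⟩ := h₁₀.exists_bound
  obtain ⟨C₂₀, hC₂₀⟩ := h₂₀.exists_bound
  obtain ⟨C₂₁, hC₂₁⟩ := h₂₁.exists_bound
  obtain ⟨C₃₀, hC₃₀⟩ := h₃₀.exists_bound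
  obtain ⟨C₃₁, hC₃₁⟩ := h₃₁.exists_bound
  obtain ⟨C₃₂, hC₃₂⟩ := h₃₂.exists_bound
  set B₁ := 3 * |C₁₀| + 1 with hB₁'
  set B₂ := 3 * (|C₂₀| + |C₂₁| * B₁) + B₁ with hB₂'
  set B₃ := 3 * (|C₃₀| + |C₃₁| * B₁ + |C₃₂| * B₂) + 2 * B₂ with hB₃'
  have hB₁ : 0 < B₁ := by positivity
  have hB₁₂ : B₁ ≤ B₂ := by
    have : 0 ≤ 3 * (|C₂₀| + |C₂₁| * B₁) := by positivity
    linarith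
  have hB₂ : 0 < B₂ := hB₁.trans_le hB₁₂
  have hB₂₃ : 2 * B₂ ≤ B₃ := by
    have : 0 ≤ 3 * (|C₃₀| + |C₃₁| * B₁ + |C₃₂| * B₂) := by positivity
    linarith
  have hB₃ : 0 < B₃ := by linarith
  refine ⟨B₁, B₂, B₃, hB₁, hB₂, hB₃, fun β hβ φ hφ => ?_⟩
  obtain ⟨φ₁, φ₂, φ₃, h₁, h₂, h₃, hb⟩ := hφ
  obtain ⟨L₁, H⟩ := H β hβ φ φ₁ h₁
  obtain ⟨L₂, H⟩ := H φ₂ h₂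
  have L₃ := H φ₃ h₃
  have R₁ := EulerDeriv.lsvTransfer hβ L₁ h₁.right_one
  have R₂ := L₂.add h₂.right_two
  have R₃ := L₃.add (h₂.right_three h₃)
  refine ⟨_, _, _, R₁, R₂, R₃,
    fun x hx => ⟨lsvTransfer_nonneg hβ (fun x hx => (hb x hx).1) x hx, ?_⟩⟩
  obtain ⟨p0, p1, p2, p3⟩ := hb _ (lsvLeftInv_mapsTo hβ hx)
  obtain ⟨q0, q1, q2, q3⟩ := hb _ (right_mapsTo hx)
  simp only at q0 q1 q2 q3
  obtain ⟨hρ0, hρ1⟩ := div_add_one_mem hx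
  rw [mul_lsvTransfer_eq hβ _ φ hx, mul_lsvTransfer_eq hβ _ φ hx, mul_lsvTransfer_eq hβ _ φ hx]
  set ρ := x / (x + 1)
  set g := lsvLeftInv β x
  set y := (x + 1) / 2
  have p0' : |φ g| ≤ 1 * φ g := by rw [abs_of_nonneg p0, one_mul]
  have half : |(1 / 2 : ℝ)| = 2⁻¹ := by norm_num
  obtain ⟨a0, a1, a2, a3, a4, a5⟩ := right_weight_bounds hρ0 hρ1
  refine ⟨(abs_add_le _ _).trans (add_le_add ?_ ?_), (abs_add_le _ _).trans (add_le_add ?_ ?_),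
    (abs_add_le _ _).trans (add_le_add ?_ ?_)⟩
  · have := abs_left_le hβ hx one_ne_zero hB₁.le (show 3 * |C₁₀| ≤ B₁ by simp [B₁]) p0 p1
      (D := c₁₀ β x * φ g) (by
        simpa using abs_mul_le_of_abs_le ((hC₁₀ β hβ x hx).trans (le_abs_self _)) p0')
    rwa [pow_one] at this
  · rw [abs_mul, half]
    have := abs_mul_le_of_abs_le a0 q1
    linarith
  · refine abs_left_le hβ hx two_ne_zero hB₂.le (C := |C₂₀| + |C₂₁| * B₁)
      (by linarith) p0 p2 ((abs_add_le _ _).trans ?_)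
    have e1 := abs_mul_le_of_abs_le ((hC₂₀ β hβ x hx).trans (le_abs_self _)) p0'
    have e2 := abs_mul_le_of_abs_le ((hC₂₁ β hβ x hx).trans (le_abs_self _)) p1
    linarith
  · rw [abs_mul, half]
    have e1 := abs_mul_le_of_abs_le a2 q2
    have e2 := abs_mul_le_of_abs_le a1 q1
    have e3 := abs_add_le (ρ ^ 2 * φ₂ y) (ρ * (1 - ρ) * φ₁ y)
    have e4 := mul_le_mul_of_nonneg_right hB₁₂ q0
    have e5 := mul_nonneg hB₂.le q0
    linarith
  · refine abs_left_le hβ hx three_ne_zero hB₃.le (C := |C₃₀| + |C₃₁| * B₁ + |C₃₂| * B₂)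
      (by linarith) p0 p3 ((abs_add_three _ _ _).trans ?_)
    have e1 := abs_mul_le_of_abs_le ((hC₃₀ β hβ x hx).trans (le_abs_self _)) p0'
    have e2 := abs_mul_le_of_abs_le ((hC₃₁ β hβ x hx).trans (le_abs_self _)) p1
    have e3 := abs_mul_le_of_abs_le ((hC₃₂ β hβ x hx).trans (le_abs_self _)) p2
    linarith
  · rw [abs_mul, half]
    have e1 := abs_mul_le_of_abs_le a3 q3
    have e2 := abs_mul_le_of_abs_le a4 q2
    have e3 := abs_mul_le_of_abs_le a5 q1
    have e4 := abs_add_three (ρ ^ 3 * φ₃ y) (3 * (ρ ^ 2 * (1 - ρ)) * φ₂ y)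
      (ρ * (1 - ρ) * (1 - 2 * ρ) * φ₁ y)
    have e5 := mul_le_mul_of_nonneg_right hB₁₂ q0
    have e6 := mul_le_mul_of_nonneg_right hB₂₃ q0
    have e7 := mul_nonneg hB₂.le q0
    linarith

lemma one_mem_coneThree {B₁ B₂ B₃ : ℝ} (h₁ : 0 < B₁) (h₂ : 0 < B₂) (h₃ : 0 < B₃) :
    (fun _ => 1 : ℝ → ℝ) ∈ coneThree B₁ B₂ B₃ :=
  ⟨_, _, _, .const 1, .const 0, .const 0, fun x _ => by simp [h₁.le, h₂.le, h₃.le]⟩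

lemma one_mem_coneTwo (h₁ : 0 < b₁) (h₂ : 0 < b₂) : (fun _ => 1 : ℝ → ℝ) ∈ coneTwo b₁ b₂ :=
  mem_coneTwo_of_eulerDeriv (.const 1) (.const 0) continuousOn_const fun x _ => by
    simp [h₁.le, h₂.le]

end DerivativeCones

/-! ### Pointwise limits of functions with bounded derivatives -/

section Limits

/-- Taylor's formula of order one with a bound on the second derivative. -/
lemma abs_sub_sub_mul_le_of_hasDerivWithinAt {u v w : ℝ → ℝ} {x₀ M : ℝ} (hx₀ : 0 < x₀)
    (hu : ∀ x ∈ Ioc (0 : ℝ) 1, HasDerivWithinAt u (v x) (Ioc 0 1) x)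
    (hv : ∀ x ∈ Ioc (0 : ℝ) 1, HasDerivWithinAt v (w x) (Ioc 0 1) x)
    (hw : ∀ x ∈ Icc x₀ 1, |w x| ≤ M) {x y : ℝ} (hx : x ∈ Icc x₀ 1) (hy : y ∈ Icc x₀ 1) :
    |u y - u x - (y - x) * v x| ≤ M * (y - x) ^ 2 := by
  have hsub : Icc x₀ 1 ⊆ Ioc 0 1 := fun z hz => ⟨hx₀.trans_le hz.1, hz.2⟩
  have huIcc : uIcc x y ⊆ Icc x₀ 1 := uIcc_subset_Icc hx hy
  have hM : 0 ≤ M := (abs_nonneg _).trans (hw x hx)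
  have h1 : ∀ z ∈ uIcc x y, ‖v z - v x‖ ≤ M * |y - x| := fun z hz => by
    refine ((convex_Icc x₀ 1).norm_image_sub_le_of_norm_hasDerivWithin_le
      (fun z hz => (hv z (hsub hz)).mono hsub) hw hx (huIcc hz)).trans ?_
    rw [Real.norm_eq_abs]
    exact mul_le_mul_of_nonneg_left (abs_sub_left_of_mem_uIcc hz) hM
  have h2 := (convex_uIcc x y).norm_image_sub_le_of_norm_hasDerivWithin_le
    (f := fun z => u z - z * v x) (f' := fun z => v z - v x)
    (fun z hz => by
      have := ((hu z (hsub (huIcc hz))).mono (huIcc.trans hsub)).sub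
        ((hasDerivWithinAt_id z (uIcc x y)).mul_const (v x))
      exact this.congr_deriv (by ring)) h1 left_mem_uIcc right_mem_uIcc
  rw [Real.norm_eq_abs, Real.norm_eq_abs, mul_assoc, abs_mul_abs_self, ← sq] at h2
  refine (le_of_eq ?_).trans h2
  congr 1
  ring

/-- If functions with locally bounded second derivatives converge pointwise, then so do their
derivatives, and the limit is differentiable. -/
lemma exists_tendsto_hasDerivWithinAt {u v w : ℕ → ℝ → ℝ} {U : ℝ → ℝ}
    (hu : ∀ n, ∀ x ∈ Ioc (0 : ℝ) 1, HasDerivWithinAt (u n) (v n x) (Ioc 0 1) x)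
    (hv : ∀ n, ∀ x ∈ Ioc (0 : ℝ) 1, HasDerivWithinAt (v n) (w n x) (Ioc 0 1) x)
    (hw : ∀ x₀ > 0, ∃ M, ∀ n, ∀ x ∈ Icc x₀ 1, |w n x| ≤ M)
    (hU : ∀ x ∈ Ioc (0 : ℝ) 1, Tendsto (fun n => u n x) atTop (nhds (U x))) :
    ∃ V : ℝ → ℝ, (∀ x ∈ Ioc (0 : ℝ) 1, Tendsto (fun n => v n x) atTop (nhds (V x))) ∧
      ∀ x ∈ Ioc (0 : ℝ) 1, HasDerivWithinAt U (V x) (Ioc 0 1) x := by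
  have hlim : ∀ x, ∃ L, x ∈ Ioc (0 : ℝ) 1 → Tendsto (fun n => v n x) atTop (nhds L) := by
    intro x
    by_cases hx : x ∈ Ioc (0 : ℝ) 1
    swap
    · exact ⟨0, fun h => absurd h hx⟩
    have hx0 := hx.1
    obtain ⟨M, hM⟩ := hw (x / 2) (by linarith)
    have hxI : x ∈ Icc (x / 2) 1 := ⟨by linarith, hx.2⟩
    have hM0 : 0 ≤ M := (abs_nonneg _).trans (hM 0 x hxI)
    have hC : CauchySeq fun n => v n x := by
      rw [Metric.cauchySeq_iff]
      intro ε hε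
      -- the derivative is a difference quotient with a step `s` of order `ε / M`
      set s := min (x / 2) (ε / (4 * (M + 1))) with hs
      have hs0 : 0 < s := lt_min (by linarith) (by positivity)
      have hsx : s ≤ x / 2 := min_le_left _ _
      have hsM : 4 * M * s ≤ ε := by
        have : s ≤ ε / (4 * (M + 1)) := min_le_right _ _
        rw [le_div_iff₀ (by positivity)] at this
        linarith
      have hy : x - s ∈ Icc (x / 2) 1 := ⟨by linarith, by linarith [hx.2]⟩
      have hD := (hU x hx).sub (hU (x - s) ⟨by linarith, hy.2⟩)
      obtain ⟨N, hN⟩ := Metric.cauchySeq_iff.1 hD.cauchySeq (ε / 2 * s) (by positivity)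
      refine ⟨N, fun m hm n hn => ?_⟩
      have h1 := abs_le.1 (abs_sub_sub_mul_le_of_hasDerivWithinAt (by linarith) (hu m) (hv m)
        (hM m) hxI hy)
      have h2 := abs_le.1 (abs_sub_sub_mul_le_of_hasDerivWithinAt (by linarith) (hu n) (hv n)
        (hM n) hxI hy)
      have h3 := hN m hm n hn
      rw [Real.dist_eq, abs_lt] at h3
      rw [Real.dist_eq, abs_lt]
      have h4 : M * (x - s - x) ^ 2 ≤ ε / 4 * s := by nlinarith
      constructor
      · refine lt_of_mul_lt_mul_right ?_ hs0.le
        nlinarith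
      · refine lt_of_mul_lt_mul_right ?_ hs0.le
        nlinarith
    obtain ⟨L, hL⟩ := cauchySeq_tendsto_of_complete hC
    exact ⟨L, fun _ => hL⟩
  choose V hV using hlim
  refine ⟨V, fun x hx => hV x hx, fun x hx => ?_⟩
  have hx0 := hx.1
  obtain ⟨M, hM⟩ := hw (x / 2) (by linarith)
  have hxI : x ∈ Icc (x / 2) 1 := ⟨by linarith, hx.2⟩
  have hT : ∀ y ∈ Icc (x / 2) 1, |U y - U x - (y - x) * V x| ≤ M * (y - x) ^ 2 := fun y hy =>
    le_of_tendsto (((hU y ⟨by linarith [hy.1], hy.2⟩).sub (hU x hx)).sub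
      ((hV x hx).const_mul (y - x))).abs (Eventually.of_forall fun n =>
        abs_sub_sub_mul_le_of_hasDerivWithinAt (by linarith) (hu n) (hv n) (hM n) hxI hy)
  rw [hasDerivWithinAt_iff_isLittleO]
  refine (Asymptotics.IsBigO.of_bound M (g := fun y => ‖y - x‖ ^ 2) ?_).trans_isLittleO
    ((Asymptotics.isLittleO_pow_sub_sub x one_lt_two).mono nhdsWithin_le_nhds)
  filter_upwards [self_mem_nhdsWithin,
    mem_nhdsWithin_of_mem_nhds (Ioi_mem_nhds (by linarith : x / 2 < x))] with y hy1 hy2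
  have := hT y ⟨le_of_lt hy2, hy1.2⟩
  simpa using this

end Limits

/-! ### Limits of densities -/

section LimitDensity

variable {α a b₁ b₂ B₁ B₂ B₃ : ℝ}

lemma unitConeStar_le_rpow {φ : ℝ → ℝ} (hφ : φ ∈ unitConeStar α a) {x : ℝ}
    (hx : x ∈ Ioc (0 : ℝ) 1) : φ x ≤ a * x ^ (-α) := by
  have h1 := (mul_le_setIntegral_of_antitoneOn hφ.1.2.1 hφ.1.2.2.2.1 hx).trans
    (unitConeStar_integral_le hφ hx)
  have e : x ^ (1 - α) = x * x ^ (-α) := by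
    rw [sub_eq_add_neg, Real.rpow_add hx.1, Real.rpow_one]
  rw [e] at h1
  have := hx.1
  nlinarith

lemma integrableOn_mul_rpow_neg (hα : α ∈ Ioo (0 : ℝ) 1) (a : ℝ) :
    IntegrableOn (fun x : ℝ => a * x ^ (-α)) (Ioc 0 1) := by
  have := (intervalIntegral.intervalIntegrable_rpow' (a := 0) (b := 1)
    (by linarith [hα.2] : -1 < -α)).const_mul a
  rwa [intervalIntegrable_iff_integrableOn_Ioc_of_le zero_le_one] at this

lemma tendsto_setIntegral_of_unitConeStar (hα : α ∈ Ioo (0 : ℝ) 1) {φ : ℕ → ℝ → ℝ}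
    (hφ : ∀ n, φ n ∈ unitConeStar α a) {h : ℝ → ℝ}
    (hlim : ∀ x ∈ Ioc (0 : ℝ) 1, Tendsto (fun n => φ n x) atTop (nhds (h x))) {x : ℝ}
    (hx : x ≤ 1) :
    Tendsto (fun n => ∫ t in Ioc 0 x, φ n t) atTop (nhds (∫ t in Ioc 0 x, h t)) := by
  have hsub : Ioc 0 x ⊆ Ioc (0 : ℝ) 1 := Ioc_subset_Ioc_right hx
  refine tendsto_integral_of_dominated_convergence (fun t => a * t ^ (-α))
    (fun n => ((hφ n).1.2.1.mono_set hsub).aestronglyMeasurable)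
    ((integrableOn_mul_rpow_neg hα a).mono_set hsub) (fun n => ?_) ?_
  · refine (ae_restrict_iff' measurableSet_Ioc).2 (Eventually.of_forall fun t ht => ?_)
    rw [Real.norm_eq_abs, abs_of_nonneg ((hφ n).1.2.2.1 t (hsub ht))]
    exact unitConeStar_le_rpow (hφ n) (hsub ht)
  · exact (ae_restrict_iff' measurableSet_Ioc).2 (Eventually.of_forall fun t ht =>
      hlim t (hsub ht))

/-- The set of densities is closed under pointwise limits that are continuous. -/
lemma unitConeStar_of_tendsto (hα : α ∈ Ioo (0 : ℝ) 1) {φ : ℕ → ℝ → ℝ}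
    (hφ : ∀ n, φ n ∈ unitConeStar α a) {h : ℝ → ℝ}
    (hlim : ∀ x ∈ Ioc (0 : ℝ) 1, Tendsto (fun n => φ n x) atTop (nhds (h x)))
    (hc : ContinuousOn h (Ioc 0 1)) : h ∈ unitConeStar α a := by
  have h0 : ∀ x ∈ Ioc (0 : ℝ) 1, 0 ≤ h x := fun x hx =>
    ge_of_tendsto' (hlim x hx) fun n => (hφ n).1.2.2.1 x hx
  have hle : ∀ x ∈ Ioc (0 : ℝ) 1, h x ≤ a * x ^ (-α) := fun x hx =>
    le_of_tendsto' (hlim x hx) fun n => unitConeStar_le_rpow (hφ n) hx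
  have hi : IntegrableOn h (Ioc 0 1) := by
    refine (integrableOn_mul_rpow_neg hα a).mono' (hc.aestronglyMeasurable measurableSet_Ioc)
      ((ae_restrict_iff' measurableSet_Ioc).2 (Eventually.of_forall fun t ht => ?_))
    rw [Real.norm_eq_abs, abs_of_nonneg (h0 t ht)]
    exact hle t ht
  have h1 : ∫ t in Ioc 0 1, h t = 1 := by
    have := tendsto_setIntegral_of_unitConeStar hα hφ hlim le_rfl
    simp only [(hφ _).2] at this
    exact (tendsto_nhds_unique this tendsto_const_nhds)
  refine ⟨⟨hc, hi, h0, fun x hx y hy hxy => ?_, fun x hx y hy hxy => ?_, fun x hx => ?_⟩, h1⟩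
  · exact le_of_tendsto_of_tendsto' (hlim y hy) (hlim x hx) fun n =>
      (hφ n).1.2.2.2.1 hx hy hxy
  · exact le_of_tendsto_of_tendsto' ((hlim x hx).const_mul _) ((hlim y hy).const_mul _) fun n =>
      (hφ n).1.2.2.2.2.1 hx hy hxy
  · rw [intervalIntegral.integral_of_le hx.1.le, intervalIntegral.integral_of_le zero_le_one, h1,
      mul_one]
    exact le_of_tendsto' (tendsto_setIntegral_of_unitConeStar hα hφ hlim hx.2) fun n =>
      unitConeStar_integral_le (hφ n) hx

lemma tendsto_integral_abs_sub_of_unitConeStar (hα : α ∈ Ioo (0 : ℝ) 1) {φ : ℕ → ℝ → ℝ}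
    (hφ : ∀ n, φ n ∈ unitConeStar α a) {h : ℝ → ℝ} (hh : h ∈ unitConeStar α a)
    (hlim : ∀ x ∈ Ioc (0 : ℝ) 1, Tendsto (fun n => φ n x) atTop (nhds (h x))) :
    Tendsto (fun n => ∫ t in Ioc 0 1, |φ n t - h t|) atTop (nhds 0) := by
  have := tendsto_integral_of_dominated_convergence (μ := volume.restrict (Ioc (0 : ℝ) 1))
    (F := fun n t => |φ n t - h t|) (f := fun _ => 0) (fun t => 2 * (a * t ^ (-α)))
    (fun n => ((hφ n).1.2.1.sub hh.1.2.1).abs.aestronglyMeasurable)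
    ((integrableOn_mul_rpow_neg hα a).const_mul 2) (fun n => ?_) ?_
  · simpa using this
  · refine (ae_restrict_iff' measurableSet_Ioc).2 (Eventually.of_forall fun t ht => ?_)
    rw [Real.norm_eq_abs, abs_abs, abs_le]
    have h1 := (hφ n).1.2.2.1 t ht
    have h2 := hh.1.2.2.1 t ht
    have h3 := unitConeStar_le_rpow (hφ n) ht
    have h4 := unitConeStar_le_rpow hh ht
    constructor <;> linarith
  · refine (ae_restrict_iff' measurableSet_Ioc).2 (Eventually.of_forall fun t ht => ?_)
    simpa using ((hlim t ht).sub_const (h t)).abs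

/-- The bounds of the cone `C_2(b₁, b₂)` pass to pointwise limits of densities whose third
derivatives are controlled. -/
lemma coneTwo_of_tendsto {φ : ℕ → ℝ → ℝ} (hφ : ∀ n, φ n ∈ unitConeStar α a)
    (h₂ : ∀ n, φ n ∈ coneTwo b₁ b₂) (h₃ : ∀ n, φ n ∈ coneThree B₁ B₂ B₃) {h : ℝ → ℝ}
    (hlim : ∀ x ∈ Ioc (0 : ℝ) 1, Tendsto (fun n => φ n x) atTop (nhds (h x))) :
    h ∈ coneTwo b₁ b₂ := by
  choose φ₁ φ₂ φ₃ E₁ E₂ E₃ hb using h₃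
  -- the ordinary derivatives
  set v : ℕ → ℝ → ℝ := fun n x => φ₁ n x / x with hv
  set w : ℕ → ℝ → ℝ := fun n x => (φ₂ n x - φ₁ n x) / x ^ 2 with hw
  set z : ℕ → ℝ → ℝ := fun n x => (φ₃ n x - 3 * φ₂ n x + 2 * φ₁ n x) / x ^ 3 with hz
  have Hu : ∀ n, ∀ x ∈ Ioc (0 : ℝ) 1, HasDerivWithinAt (φ n) (v n x) (Ioc 0 1) x := E₁
  have Hv : ∀ n, ∀ x ∈ Ioc (0 : ℝ) 1, HasDerivWithinAt (v n) (w n x) (Ioc 0 1) x :=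
    fun n x hx => (E₂ n).hasDerivWithinAt_div hx
  have Hw : ∀ n, ∀ x ∈ Ioc (0 : ℝ) 1, HasDerivWithinAt (w n) (z n x) (Ioc 0 1) x := by
    intro n x hx
    have hx0 := hx.1
    refine (((E₃ n x hx).sub (E₂ n x hx)).div ((hasDerivAt_pow 2 x).hasDerivWithinAt)
      (pow_ne_zero 2 hx0.ne')).congr_deriv ?_
    simp only [hz, Pi.sub_apply]
    field_simp
    ring
  have hφle : ∀ x₀ > 0, ∀ n, ∀ x ∈ Icc x₀ 1, φ n x ≤ 1 / x₀ := fun x₀ hx₀ n x hx => by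
    have hx1 : x ∈ Ioc (0 : ℝ) 1 := ⟨hx₀.trans_le hx.1, hx.2⟩
    rw [le_div_iff₀ hx₀]
    nlinarith [unitConeStar_mul_le (hφ n) hx1, (hb n x hx1).1, hx.1]
  have bound : ∀ (k : ℕ) (B : ℝ) (F : ℕ → ℝ → ℝ), 0 ≤ B →
      (∀ n, ∀ x ∈ Ioc (0 : ℝ) 1, |F n x| ≤ B * φ n x) →
      ∀ x₀ > 0, ∃ M, ∀ n, ∀ x ∈ Icc x₀ 1, |F n x / x ^ k| ≤ M := by
    intro k B F hB hF x₀ hx₀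
    refine ⟨B * (1 / x₀) / x₀ ^ k, fun n x hx => ?_⟩
    have hx1 : x ∈ Ioc (0 : ℝ) 1 := ⟨hx₀.trans_le hx.1, hx.2⟩
    rw [abs_div, abs_of_pos (pow_pos hx1.1 k)]
    have h1 := (hF n x hx1).trans (mul_le_mul_of_nonneg_left (hφle x₀ hx₀ n x hx) hB)
    exact div_le_div₀ (by positivity) h1 (pow_pos hx₀ k) (pow_le_pow_left₀ hx₀.le hx.1 k)
  have bw := bound 2 (|B₂| + |B₁|) (fun n x => φ₂ n x - φ₁ n x) (by positivity)
    fun n x hx => by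
      obtain ⟨p0, p1, p2, -⟩ := hb n x hx
      have e1 := abs_sub (φ₂ n x) (φ₁ n x)
      have e2 := mul_le_mul_of_nonneg_right (le_abs_self B₂) p0
      have e3 := mul_le_mul_of_nonneg_right (le_abs_self B₁) p0
      linarith
  have bz := bound 3 (|B₃| + 3 * |B₂| + 2 * |B₁|)
    (fun n x => φ₃ n x - 3 * φ₂ n x + 2 * φ₁ n x) (by positivity)
    fun n x hx => by
      obtain ⟨p0, p1, p2, p3⟩ := hb n x hx
      have e0 := mul_le_mul_of_nonneg_right (le_abs_self B₃) p0
      have e2 := mul_le_mul_of_nonneg_right (le_abs_self B₂) p0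
      have e3 := mul_le_mul_of_nonneg_right (le_abs_self B₁) p0
      rw [abs_le] at p1 p2 p3 ⊢
      constructor <;> linarith
  obtain ⟨V, hV, hUV⟩ := exists_tendsto_hasDerivWithinAt Hu Hv bw hlim
  obtain ⟨W, hW, hVW⟩ := exists_tendsto_hasDerivWithinAt Hv Hw bz hV
  have hWc : ContinuousOn W (Ioc 0 1) := by
    intro x hx
    have hx0 := hx.1
    obtain ⟨M, hM⟩ := bz (x / 2) (by linarith)
    have hsub : Icc (x / 2) 1 ⊆ Ioc 0 1 := fun z hz => ⟨by linarith [hz.1], hz.2⟩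
    have hxI : x ∈ Icc (x / 2) 1 := ⟨by linarith, hx.2⟩
    have hL : ∀ y ∈ Icc (x / 2) 1, |W y - W x| ≤ M * |y - x| := fun y hy =>
      le_of_tendsto' ((hW y (hsub hy)).sub (hW x hx)).abs fun n =>
        (convex_Icc (x / 2) 1).norm_image_sub_le_of_norm_hasDerivWithin_le
          (fun z hz => (Hw n z (hsub hz)).mono hsub) (hM n) hxI hy
    rw [ContinuousWithinAt, tendsto_iff_norm_sub_tendsto_zero]
    have h0 : Tendsto (fun y => M * |y - x|) (nhdsWithin x (Ioc 0 1)) (nhds 0) := by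
      have : Continuous fun y => M * |y - x| := by fun_prop
      simpa using (this.tendsto x).mono_left nhdsWithin_le_nhds
    refine squeeze_zero' (Eventually.of_forall fun y => norm_nonneg _) ?_ h0
    filter_upwards [self_mem_nhdsWithin,
      mem_nhdsWithin_of_mem_nhds (Ioi_mem_nhds (by linarith : x / 2 < x))] with y hy1 hy2
    exact hL y ⟨le_of_lt hy2, hy1.2⟩
  obtain ⟨hC, hd⟩ := contDiffOn_two_of_hasDerivWithinAt hUV hVW hWc
  refine ⟨hC, fun x hx => ?_⟩
  rw [(hd x hx).1, (hd x hx).2]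
  have hn : ∀ n, 0 ≤ φ n x ∧ |v n x| ≤ b₁ / x * φ n x ∧ |w n x| ≤ b₂ / x ^ 2 * φ n x := by
    intro n
    have h1 := (h₂ n).2 x hx
    obtain ⟨-, hd'⟩ := contDiffOn_two_of_hasDerivWithinAt (Hu n) (Hv n)
      fun x hx => (Hw n x hx).continuousWithinAt
    rwa [(hd' x hx).1, (hd' x hx).2] at h1
  exact ⟨ge_of_tendsto' (hlim x hx) fun n => (hn n).1,
    le_of_tendsto_of_tendsto' (hV x hx).abs ((hlim x hx).const_mul _) fun n => (hn n).2.1,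
    le_of_tendsto_of_tendsto' (hW x hx).abs ((hlim x hx).const_mul _) fun n => (hn n).2.2⟩

end LimitDensity

/-! ### The equivariant densities -/

section Equivariant

variable {α a b₁ b₂ : ℝ} {β : ℤ → ℝ}

lemma transferComp_split (k : ℤ) {n m : ℕ} (h : n ≤ m) (φ : ℝ → ℝ) :
    transferComp β (k - m) m φ =
      transferComp β (k - n) n (transferComp β (k - m) (m - n) φ) := by
  obtain ⟨d, rfl⟩ := Nat.exists_eq_add_of_le h
  have e : k - ((n + d : ℕ) : ℤ) + (d : ℕ) = k - n := by push_cast; ring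
  rw [Nat.add_sub_cancel_left, ← e, ← transferComp_add, add_comm d n]

lemma transferComp_eqOn_of_equivariant (hβ : ∀ k, β k ∈ Ioo (0 : ℝ) 1) {h : ℤ → ℝ → ℝ}
    (hh : IsEquivariant β h) (j : ℤ) (n : ℕ) :
    EqOn (transferComp β j n (h j)) (h (j + n)) (Ioc 0 1) := by
  induction n with
  | zero => intro x _; simp [transferComp]
  | succ n ih =>
    intro x hx
    rw [transferComp_succ, lsvTransfer_eqOn (hβ _) ih hx, (hh (j + n)).1 hx]
    push_cast
    rw [add_assoc]

lemma eqOn_of_integral_abs_sub_eq_zero {φ ψ : ℝ → ℝ} (hφ : φ ∈ coneStar α a)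
    (hψ : ψ ∈ coneStar α a) (h : ∫ t in Ioc 0 1, |φ t - ψ t| = 0) : EqOn φ ψ (Ioc 0 1) := by
  have h1 := (setIntegral_eq_zero_iff_of_nonneg_ae
    (Eventually.of_forall fun t => abs_nonneg (φ t - ψ t)) (hφ.2.1.sub hψ.2.1).abs).1 h
  have h2 : φ =ᵐ[volume.restrict (Ioc 0 1)] ψ := h1.mono fun t ht => by
    have : |φ t - ψ t| = 0 := ht
    rwa [abs_eq_zero, sub_eq_zero] at this
  refine Measure.eqOn_of_ae_eq h2 hφ.1 hψ.1 ?_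
  rw [interior_Ioc, closure_Ioo (by norm_num)]
  exact Ioc_subset_Icc_self

lemma lebesgueUnit_eq : lebesgueUnit = volume.restrict (Ioc 0 1) :=
  (Measure.restrict_congr_set Ioc_ae_eq_Icc).symm

/-- The `n`-th image of Lebesgue measure has density `L^n 1`. -/
lemma map_lsvComp_real (hβ : ∀ k, β k ∈ Ioo (0 : ℝ) 1) (j : ℤ) (n : ℕ) {B : Set ℝ}
    (hB : MeasurableSet B) : (lebesgueUnit.map (lsvComp β j n)).real B =
      ∫ x in B ∩ Ioc 0 1, transferComp β j n (fun _ => 1) x := by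
  rw [setIntegral_transferComp hβ j n (integrableOn_const (by simp)) hB, setIntegral_const,
    smul_eq_mul, mul_one, lebesgueUnit_eq, measureReal_def, measureReal_def,
    Measure.map_apply (measurable_lsvComp j n) hB,
    Measure.restrict_apply (measurable_lsvComp j n hB)]

lemma withDensity_real {h : ℝ → ℝ} (hi : IntegrableOn h (Ioc 0 1))
    (h0 : ∀ x ∈ Ioc (0 : ℝ) 1, 0 ≤ h x) {B : Set ℝ} (hB : MeasurableSet B) :
    (lebesgueUnit.withDensity fun x => ENNReal.ofReal (h x)).real B =
      ∫ x in B ∩ Ioc 0 1, h x := by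
  rw [measureReal_def, withDensity_apply _ hB, lebesgueUnit_eq, Measure.restrict_restrict hB,
    integral_eq_lintegral_of_nonneg_ae _ (hi.mono_set inter_subset_right).aestronglyMeasurable]
  exact (ae_restrict_iff' (hB.inter measurableSet_Ioc)).2
    (Eventually.of_forall fun x hx => h0 x hx.2)

end Equivariant

theorem proposition4p6 (α : ℝ) (hα : α ∈ Set.Ioo (0 : ℝ) 1) :
    (∃ a b₁ b₂ : ℝ, InvariantConeParameters α a b₁ b₂) ∧
    ∀ a b₁ b₂ : ℝ, InvariantConeParameters α a b₁ b₂ →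
      ∀ β : ℤ → ℝ, (∀ k, β k ∈ Set.Ioo (0 : ℝ) 1) → (⨆ k, β k) = α →
        ∃ h : ℤ → ℝ → ℝ,
          (∀ k, h k ∈ coneStar α a ∩ coneTwo b₁ b₂) ∧
          IsEquivariant β h ∧
          (∀ h' : ℤ → ℝ → ℝ, (∀ k, h' k ∈ coneStar α a) → IsEquivariant β h' →
            ∀ k, Set.EqOn (h' k) (h k) (Set.Ioc 0 1)) ∧
          IsSRBState β
            (fun k => lebesgueUnit.withDensity (fun x => ENNReal.ofReal (h k x))) := by
  have hα1 : 0 < 1 - α := by linarith [hα.2]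
  refine ⟨?_, fun a b₁ b₂ hP β hβ hsup => ?_⟩
  · obtain ⟨b₁, b₂, hb₁, hb₂, hb⟩ := exists_lsvTransfer_mapsTo_coneTwo
    have ha : 1 < 4 / (1 - α) := by
      rw [lt_div_iff₀ hα1]; linarith [hα.1]
    exact ⟨4 / (1 - α), b₁, b₂, ha, hb₁, hb₂,
      fun β hβ => lsvTransfer_mapsTo_coneStar hα hβ le_rfl,
      fun β hβ => hb β ⟨hβ.1, hβ.2.trans_lt hα.2⟩⟩
  have hβα : ∀ k, β k ∈ Ioc 0 α := fun k =>
    ⟨(hβ k).1, hsup ▸ le_ciSup ⟨1, by rintro _ ⟨k, rfl⟩; exact (hβ k).2.le⟩ k⟩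
  have hS : ∀ k, MapsTo (lsvTransfer (β k)) (coneStar α a) (coneStar α a) := fun k =>
    hP.mapsTo_coneStar _ (hβα k)
  obtain ⟨B₁, B₂, B₃, hB₁, hB₂, hB₃, hB⟩ := exists_lsvTransfer_mapsTo_coneThree
  have one_mem : (fun _ => 1 : ℝ → ℝ) ∈ unitConeStar α a :=
    ⟨one_mem_coneStar hα hP.one_lt_a, by simp⟩
  set φ : ℤ → ℕ → ℝ → ℝ := fun k n => transferComp β (k - n) n (fun _ => 1) with hφdef
  have hφ : ∀ k n, φ k n ∈ unitConeStar α a := fun k n =>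
    transferComp_mem_unitConeStar hβ hS _ n one_mem
  have hφ₂ : ∀ k n, φ k n ∈ coneTwo b₁ b₂ := fun k n =>
    transferComp_mapsTo (fun k => hP.mapsTo_coneTwo _ (hβα k)) _ n
      (one_mem_coneTwo hP.b₁_pos hP.b₂_pos)
  have hφ₃ : ∀ k n, φ k n ∈ coneThree B₁ B₂ B₃ := fun k n =>
    transferComp_mapsTo (fun k => hB _ (hβ k)) _ n (one_mem_coneThree hB₁ hB₂ hB₃)
  -- the pull-back sequence is Cauchy in `L¹` by loss of memory, hence pointwise
  have hlim : ∀ k x, ∃ L, x ∈ Ioc (0 : ℝ) 1 → Tendsto (fun n => φ k n x) atTop (nhds L) := by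
    intro k x
    by_cases hx : x ∈ Ioc (0 : ℝ) 1
    swap
    · exact ⟨0, fun h => absurd h hx⟩
    have hC : CauchySeq fun n => φ k n x := by
      rw [Metric.cauchySeq_iff']
      intro ε hε
      obtain ⟨δ, hδ, H⟩ := unitConeStar_sub_lt_of_integral_lt (a := a) hα hε hx
      obtain ⟨M, hM⟩ := exists_forall_integral_transferComp_sub_lt hα hβ hS hδ
      refine ⟨M, fun n hn => ?_⟩
      have h1 := hM (k - M) _ (transferComp_mem_unitConeStar hβ hS (k - n) (n - M) one_mem) _
        one_mem M le_rfl
      rw [← transferComp_split k hn] at h1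
      have h2 := H _ (hφ k n) _ (hφ k M) h1
      have h3 := H _ (hφ k M) _ (hφ k n) (by simpa only [abs_sub_comm] using h1)
      rw [Real.dist_eq, abs_lt]
      constructor <;> linarith
    obtain ⟨L, hL⟩ := cauchySeq_tendsto_of_complete hC
    exact ⟨L, fun _ => hL⟩
  choose h hh using hlim
  have h₂ : ∀ k, h k ∈ coneTwo b₁ b₂ := fun k =>
    coneTwo_of_tendsto (hφ k) (hφ₂ k) (hφ₃ k) (hh k)
  have h₁ : ∀ k, h k ∈ unitConeStar α a := fun k =>
    unitConeStar_of_tendsto hα (hφ k) (hh k) (h₂ k).1.continuousOn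
  have hequi : IsEquivariant β h := by
    intro k
    refine ⟨fun x hx => ?_, by rw [intervalIntegral.integral_of_le zero_le_one, (h₁ k).2]⟩
    have e : ∀ n, φ (k + 1) (n + 1) x = lsvTransfer (β k) (φ k n) x := by
      intro n
      have e1 : k + 1 - ((n + 1 : ℕ) : ℤ) = k - n := by push_cast; ring
      simp only [hφdef]
      rw [e1, transferComp_succ, sub_add_cancel]
    have t1 := (hh (k + 1) x hx).comp (tendsto_add_atTop_nat 1)
    refine tendsto_nhds_unique ?_ t1
    simp only [Function.comp_def, e, lsvTransfer_eq (hβ k) _ hx]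
    exact ((hh k _ (lsvLeftInv_mapsTo (hβ k) hx)).div_const _).add
      ((hh k _ (right_mapsTo hx)).div_const _)
  refine ⟨h, fun k => ⟨(h₁ k).1, h₂ k⟩, hequi, fun h' hh' hequi' k => ?_, fun k => ?_⟩
  · refine eqOn_of_integral_abs_sub_eq_zero (hh' k) (h₁ k).1 (le_antisymm ?_
      (integral_nonneg fun t => abs_nonneg _))
    refine le_of_forall_pos_lt_add fun ε hε => ?_
    rw [zero_add]
    obtain ⟨M, hM⟩ := exists_forall_integral_transferComp_sub_lt hα hβ hS hε
    have hu : h' (k - M) ∈ unitConeStar α a := ⟨hh' _, by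
      rw [← intervalIntegral.integral_of_le zero_le_one, (hequi' _).2]⟩
    refine (le_of_eq ?_).trans_lt (hM (k - M) _ hu _ (h₁ (k - M)) M le_rfl)
    refine setIntegral_congr_fun measurableSet_Ioc fun t ht => ?_
    rw [transferComp_eqOn_of_equivariant hβ hequi' _ M ht,
      transferComp_eqOn_of_equivariant hβ hequi _ M ht, sub_add_cancel]
  · rw [Metric.tendstoUniformlyOn_iff]
    intro ε hε
    filter_upwards [(tendsto_integral_abs_sub_of_unitConeStar hα (hφ k) (h₁ k)
      (hh k)).eventually_lt_const hε] with n hn B hB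
    have hi := (h₁ k).1.2.1
    have hin := (hφ k n).1.2.1
    have hsub : B ∩ Ioc 0 1 ⊆ Ioc (0 : ℝ) 1 := inter_subset_right
    rw [map_lsvComp_real hβ _ _ hB, withDensity_real hi (h₁ k).1.2.2.1 hB, dist_comm,
      Real.dist_eq, ← integral_sub (hin.mono_set hsub) (hi.mono_set hsub)]
    exact (abs_integral_le_integral_abs.trans
      (setIntegral_Ioc_le (hin.sub hi).abs (fun t _ => abs_nonneg _) hsub)).trans_lt hn
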